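/- Let $X$ and $S$ be real analytic manifolds (Hausdorff, countable at infinity). Let $\mathrm{op}(X_{sa})$ be the category of subanalytic open subsets of $X$ (morphisms are inclusions), where a family $\mathcal U$ of subanalytic open subsets of $U$ is a covering of $U$ if for every compact $K\subset X$ there is a finite $\mathcal U_0\subset\mathcal U$ with $K\cap\bigcup_{U'\in\mathcal U_0}U'=K\cap U$. * The site $X_{sa}\times S_{sa}$. Let $\mathcal T$ be the family of products $U\times V$ of relatively compact subanalytic open subsets $U\subset X$, $V\subset S$. The objects of $X_{sa}\times S_{sa}$ are the locally finite (in $X\times S$) unions of elements of $\mathcal T$; a family of subobjects of $W$ is a covering of $W$ if, for every $Q\in\mathcal T$ with $Q\subset W$, its restriction to $Q$ admits a finite subfamily with union $Q$. * The site $X_{sa}\times S$. Its objects are the finite unions of products $U\times V$ with $U\subset X$ subanalytic open and $V\subset S$ open. Its Grothendieck topology is generated by the following coverings: a family covers $U\times V$ if it is refined by a family $\{U_i\times V_j\}_{i\in I,j\in J}$ with $\{U_i\}_{i\in I}$ a covering of $U$ in $X_{sa}$ and $\{V_j\}_{j\in J}$ an open covering of $V$; a family covers a general $W$ if its restriction to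 every $U\times V\subset W$ ($U$ subanalytic open, $V$ open) is a covering. * For a sheaf $F$ of $\mathbb C$-vector spaces on $X_{sa}\times S_{sa}$, the inverse image $a^{-1}F$ is the sheaf on $X_{sa}\times S$ associated with the presheaf $W\mapsto\varinjlim_{W'\supset W}\Gamma(W';F)$, where $W'$ runs over the objects of $X_{sa}\times S_{sa}$ containing $W$. For $W'$ an object of both sites there is a canonical morphism $\Gamma(W';F)\to\Gamma(W';a^{-1}F)$. * For objects $W'\subset W$ of $X_{sa}\times S$, $W'$ is weakly quasi-compact in $W$, written $W'\overset{wc}{\to}W$, if for every covering of $W$ its restriction to $W'$ admits a finite refinement that is a covering of $W'$. Let $F$ be a sheaf of $\mathbb C$-vector spaces on $X_{sa}\times S_{sa}$. (a) For every subanalytic open $U\subset X$ and every open $V\subset S$ there is an isomorphism $$\varprojlim_{V'\subset\subset V}\Gamma(U\times V';F)\ \simeq\ \Gamma(U\times V;a^{-1}F),$$ where $V'$ runs over the subanalytic open subsets of $S$ whose closure is compact and contained in $V$. (b) For every object $W$ of $X_{sa}\times S$ there is an isomorphism $$\varprojlim_{W'\overset{wc}{\to}W}\Gamma(W';F)\ \simeq\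 \Gamma(W;a^{-1}F),$$ where $W'$ runs over the objects of $X_{sa}\times S$ that are also objects of $X_{sa}\times S_{sa}$ and are weakly quasi-compact in $W$. Both isomorphisms are the canonical ones: composed with the restriction to $U\times V'$ (resp. $W'$) they equal the projection of the limit to $\Gamma(U\times V';F)$ (resp. $\Gamma(W';F)$) followed by the canonical morphism to $\Gamma(U\times V';a^{-1}F)$ (resp. $\Gamma(W';a^{-1}F)$). -/

import Mathlib

open CategoryTheory CategoryTheory.Limits Opposite TopologicalSpace
open scoped Manifold ContDiff Topology

universe u v w

namespace RelSub

section Subanalytic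

variable {E H P : Type*} [NormedAddCommGroup E] [NormedSpace ℝ E] [TopologicalSpace H]
  [TopologicalSpace P] [ChartedSpace H P]

/-- The family of subsets of `U` generated by the sets `{f > 0}`, with `f` real analytic on `U`,
under finite unions and complements in `U` (hence also under finite intersections). -/
inductive AnalyticDescribed (I : ModelWithCorners ℝ E H) (U : Set P) : Set P → Prop
  | pos (f : P → ℝ) (hf : ContMDiffOn I 𝓘(ℝ, ℝ) ω f U) : AnalyticDescribed I U {q ∈ U | 0 < f q}
  | union {A B : Set P} (hA : AnalyticDescribed I U A) (hB : AnalyticDescribed I U B) :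
      AnalyticDescribed I U (A ∪ B)
  | compl {A : Set P} (hA : AnalyticDescribed I U A) : AnalyticDescribed I U (U \ A)

/-- A subset of a real analytic manifold is semianalytic if it is, near every point `p` of the
manifold, described by finitely many analytic equations and inequalities. -/
def IsSemianalytic (I : ModelWithCorners ℝ E H) (A : Set P) : Prop :=
  ∀ p : P, ∃ U : Set P, IsOpen U ∧ p ∈ U ∧ AnalyticDescribed I U (A ∩ U)

/-- A subset `A` of a real analytic manifold `X` of dimension `n` is subanalytic if it coincides,
near every point `p` of the manifold, with the projection of a relatively compact semianalytic
subset of `X × ℝᵐ` for some `m`. -/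
def IsSubanalytic (n : ℕ) {X : Type*} [TopologicalSpace X]
    [ChartedSpace (EuclideanSpace ℝ (Fin n)) X] (A : Set X) : Prop :=
  ∀ p : X, ∃ U : Set X, IsOpen U ∧ p ∈ U ∧
    ∃ (m : ℕ) (B : Set (X × EuclideanSpace ℝ (Fin m))),
      IsSemianalytic ((𝓡 n).prod (𝓡 m)) B ∧ IsCompact (closure B) ∧
        A ∩ U = (Prod.fst '' B) ∩ U

theorem AnalyticDescribed.subset {I : ModelWithCorners ℝ E H} {U A : Set P}
    (h : AnalyticDescribed I U A) : A ⊆ U := by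
  induction h with
  | pos f hf => exact fun q hq => hq.1
  | union _ _ h1 h2 => exact Set.union_subset h1 h2
  | compl _ _ => exact Set.sdiff_subset

theorem AnalyticDescribed.inter {I : ModelWithCorners ℝ E H} {U A B : Set P}
    (hA : AnalyticDescribed I U A) (hB : AnalyticDescribed I U B) :
    AnalyticDescribed I U (A ∩ B) := by
  have := (hA.compl.union hB.compl).compl
  have e : U \ (U \ A ∪ U \ B) = A ∩ B := by
    ext q
    have h1 : q ∈ A → q ∈ U := fun h => hA.subset h
    have h2 : q ∈ B → q ∈ U := fun h => hB.subset h
    simp only [Set.mem_sdiff, Set.mem_union, Set.mem_inter_iff]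
    tauto
  rwa [e] at this

theorem AnalyticDescribed.preimage {E' H' P' : Type*} [NormedAddCommGroup E'] [NormedSpace ℝ E']
    [TopologicalSpace H'] [TopologicalSpace P'] [ChartedSpace H' P']
    {I : ModelWithCorners ℝ E H} {I' : ModelWithCorners ℝ E' H'} {g : P' → P}
    (hg : ContMDiff I' I ω g) {U A : Set P} (h : AnalyticDescribed I U A) {U' : Set P'}
    (hU : U' ⊆ g ⁻¹' U) : AnalyticDescribed I' U' (g ⁻¹' A ∩ U') := by
  induction h with
  | pos f hf =>
    have := AnalyticDescribed.pos (I := I') (U := U') (f ∘ g)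
      (hf.comp hg.contMDiffOn hU)
    convert this using 1
    ext q
    have := @hU q
    simp only [Set.mem_inter_iff, Set.mem_preimage, Set.mem_ofPred_eq, Function.comp] at *
    tauto
  | union _ _ h1 h2 =>
    rw [Set.preimage_union, Set.union_inter_distrib_right]
    exact h1.union h2
  | @compl A _ h1 =>
    convert h1.compl using 1
    ext q
    have := @hU q
    simp only [Set.mem_inter_iff, Set.mem_preimage, Set.mem_sdiff] at *
    tauto

theorem IsSemianalytic.inter {I : ModelWithCorners ℝ E H} [IsManifold I ω P] {A B : Set P}
    (hA : IsSemianalytic I A) (hB : IsSemianalytic I B) : IsSemianalytic I (A ∩ B) := by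
  intro p
  obtain ⟨U, hU, hp, h⟩ := hA p
  obtain ⟨U', hU', hp', h'⟩ := hB p
  refine ⟨U ∩ U', hU.inter hU', ⟨hp, hp'⟩, ?_⟩
  have h1 := h.preimage (U' := U ∩ U') (I' := I) contMDiff_id (fun q hq => hq.1)
  have h2 := h'.preimage (U' := U ∩ U') (I' := I) contMDiff_id (fun q hq => hq.2)
  convert h1.inter h2 using 1
  ext q
  simp only [Set.mem_inter_iff, Set.mem_preimage, id]
  tauto

theorem IsSemianalytic.preimage {E' H' P' : Type*} [NormedAddCommGroup E'] [NormedSpace ℝ E']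
    [TopologicalSpace H'] [TopologicalSpace P'] [ChartedSpace H' P']
    {I : ModelWithCorners ℝ E H} {I' : ModelWithCorners ℝ E' H'} {g : P' → P}
    (hg : ContMDiff I' I ω g) {A : Set P} (hA : IsSemianalytic I A) :
    IsSemianalytic I' (g ⁻¹' A) := by
  intro p
  obtain ⟨U, hU, hp, h⟩ := hA (g p)
  refine ⟨g ⁻¹' U, hU.preimage hg.continuous, hp, ?_⟩
  convert h.preimage hg (U' := g ⁻¹' U) subset_rfl using 1
  ext q
  simp

variable {n : ℕ} {X : Type*} [TopologicalSpace X] [ChartedSpace (EuclideanSpace ℝ (Fin n)) X]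
  [IsManifold (𝓡 n) ω X]

theorem IsSubanalytic.inter [T2Space X] {A A' : Set X} (hA : IsSubanalytic n A)
    (hA' : IsSubanalytic n A') : IsSubanalytic n (A ∩ A') := by
  intro p
  obtain ⟨U, hU, hp, m, B, hB, hBc, e⟩ := hA p
  obtain ⟨U', hU', hp', m', B', hB', hBc', e'⟩ := hA' p
  let l : EuclideanSpace ℝ (Fin (m + m')) →L[ℝ] EuclideanSpace ℝ (Fin m) :=
    LinearMap.toContinuousLinearMap
      { toFun := fun z => WithLp.toLp 2 fun i => z (Fin.castAdd m' i)
        map_add' := fun _ _ => rfl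
        map_smul' := fun _ _ => rfl }
  let r : EuclideanSpace ℝ (Fin (m + m')) →L[ℝ] EuclideanSpace ℝ (Fin m') :=
    LinearMap.toContinuousLinearMap
      { toFun := fun z => WithLp.toLp 2 fun i => z (Fin.natAdd m i)
        map_add' := fun _ _ => rfl
        map_smul' := fun _ _ => rfl }
  let a : EuclideanSpace ℝ (Fin m) → EuclideanSpace ℝ (Fin m') →
      EuclideanSpace ℝ (Fin (m + m')) := fun z z' => WithLp.toLp 2 (Fin.append z z')
  have lv : ∀ z i, l z i = z (Fin.castAdd m' i) := fun _ _ => rfl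
  have rv : ∀ z i, r z i = z (Fin.natAdd m i) := fun _ _ => rfl
  have hl : ∀ z z', l (a z z') = z := fun z z' => by ext i; simp [lv, a]
  have hr : ∀ z z', r (a z z') = z' := fun z z' => by ext i; simp [rv, a]
  have ha : ∀ z, a (l z) (r z) = z := fun z => by
    ext i
    refine Fin.addCases (fun i => ?_) (fun i => ?_) i <;> simp [lv, rv, a]
  have hac : Continuous fun z : EuclideanSpace ℝ (Fin m) × EuclideanSpace ℝ (Fin m') =>
      a z.1 z.2 := by
    refine (PiLp.continuous_toLp 2 _).comp (continuous_pi fun i => ?_)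
    refine Fin.addCases (fun i => ?_) (fun i => ?_) i
    · simp only [Fin.append_left]; fun_prop
    · simp only [Fin.append_right]; fun_prop
  have hL : ContMDiff ((𝓡 n).prod (𝓡 (m + m'))) ((𝓡 n).prod (𝓡 m)) ω
      (Prod.map (id : X → X) l) := contMDiff_id.prodMap l.contMDiff
  have hR : ContMDiff ((𝓡 n).prod (𝓡 (m + m'))) ((𝓡 n).prod (𝓡 m')) ω
      (Prod.map (id : X → X) r) := contMDiff_id.prodMap r.contMDiff
  refine ⟨U ∩ U', hU.inter hU', ⟨hp, hp'⟩, m + m',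
    (Prod.map (id : X → X) l) ⁻¹' B ∩ (Prod.map (id : X → X) r) ⁻¹' B',
    (hB.preimage hL).inter (hB'.preimage hR), ?_, ?_⟩
  · have hK := (hBc.prod hBc').image (f := fun y : (X × EuclideanSpace ℝ (Fin m)) ×
        (X × EuclideanSpace ℝ (Fin m')) => (y.1.1, a y.1.2 y.2.2))
        ((continuous_fst.comp continuous_fst).prodMk
          (hac.comp ((continuous_snd.comp continuous_fst).prodMk
            (continuous_snd.comp continuous_snd))))
    refine hK.closure_of_subset ?_
    rintro ⟨x, z⟩ ⟨h1, h2⟩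
    exact ⟨((x, l z), (x, r z)), ⟨subset_closure h1, subset_closure h2⟩, by simp [ha]⟩
  · ext x
    have h1 := Set.ext_iff.1 e x
    have h2 := Set.ext_iff.1 e' x
    have h3 : x ∈ Prod.fst '' ((Prod.map (id : X → X) l) ⁻¹' B ∩
        (Prod.map (id : X → X) r) ⁻¹' B') ↔ x ∈ Prod.fst '' B ∧ x ∈ Prod.fst '' B' := by
      constructor
      · rintro ⟨⟨y, z⟩, ⟨hy, hy'⟩, rfl⟩
        exact ⟨⟨(y, l z), hy, rfl⟩, ⟨(y, r z), hy', rfl⟩⟩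
      · rintro ⟨⟨⟨y, z⟩, hy, hyx⟩, ⟨⟨y', z'⟩, hy', hyx'⟩⟩
        obtain rfl : y = x := hyx
        obtain rfl : y' = y := hyx'
        refine ⟨(y', a z z'), ⟨?_, ?_⟩, rfl⟩
        · simpa only [Set.mem_preimage, Prod.map_apply, hl, id] using hy
        · simpa only [Set.mem_preimage, Prod.map_apply, hr, id] using hy'
    simp only [Set.mem_inter_iff] at h1 h2 ⊢
    rw [h3]
    tauto

/-- Relatively compact subanalytic open sets form a basis of the topology. -/
theorem hasBasis_subanalytic [T2Space X] (x : X) :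
    (𝓝 x).HasBasis (fun V : Set X => IsOpen V ∧ x ∈ V ∧ IsSubanalytic n V ∧
      IsCompact (closure V)) id := by
  refine ⟨fun t => ⟨fun ht => ?_, fun ⟨V, hV, hVt⟩ => Filter.mem_of_superset
    (hV.1.mem_nhds hV.2.1) hVt⟩⟩
  set φ := extChartAt (𝓡 n) x with hφ
  have h1 : φ.target ∩ φ.symm ⁻¹' t ∈ 𝓝 (φ x) := by
    refine Filter.inter_mem (extChartAt_target_mem_nhds x) ?_
    exact (continuousAt_extChartAt_symm x).preimage_mem_nhds
      (by rwa [extChartAt_to_inv])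
  obtain ⟨r, hr, hrt⟩ := Metric.nhds_basis_closedBall.mem_iff.1 h1
  set V : Set X := φ.source ∩ φ ⁻¹' Metric.ball (φ x) r with hVdef
  have hK : IsCompact (φ.symm '' Metric.closedBall (φ x) r) :=
    (isCompact_closedBall _ _).image_of_continuousOn
      ((continuousOn_extChartAt_symm x).mono fun y hy => (hrt hy).1)
  have hVK : V ⊆ φ.symm '' Metric.closedBall (φ x) r := fun y hy =>
    ⟨φ y, Metric.ball_subset_closedBall hy.2, φ.left_inv hy.1⟩
  have hVc : IsCompact (closure V) := hK.closure_of_subset hVK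
  have hVo : IsOpen V := (continuousOn_extChartAt x).isOpen_inter_preimage
    (isOpen_extChartAt_source x) Metric.isOpen_ball
  have hVs : IsSemianalytic (𝓡 n) V := by
    intro p
    by_cases hp : p ∈ φ.source
    · refine ⟨φ.source, isOpen_extChartAt_source x, hp, ?_⟩
      have hf : ContMDiffOn (𝓡 n) 𝓘(ℝ, ℝ) ω (fun q => r ^ 2 - ‖φ q - φ x‖ ^ 2) φ.source := by
        have h2 : ContMDiff (𝓡 n) 𝓘(ℝ, ℝ) ω
            (fun z : EuclideanSpace ℝ (Fin n) => r ^ 2 - ‖z - φ x‖ ^ 2) := by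
          refine ContDiff.contMDiff ?_
          exact contDiff_const.sub ((contDiff_id.sub contDiff_const).norm_sq ℝ)
        exact h2.comp_contMDiffOn (by
          have := contMDiffOn_extChartAt (I := 𝓡 n) (x := x) (n := ω)
          rwa [← extChartAt_source (𝓡 n)] at this)
      convert AnalyticDescribed.pos _ hf using 1
      ext q
      simp only [hVdef, Set.mem_inter_iff, Set.mem_preimage, Metric.mem_ball, Set.mem_ofPred_eq,
        sub_pos, dist_eq_norm]
      rw [sq_lt_sq₀ (norm_nonneg _) hr.le]
      tauto
    · refine ⟨(φ.symm '' Metric.closedBall (φ x) r)ᶜ, hK.isClosed.isOpen_compl, ?_, ?_⟩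
      · rintro ⟨z, hz, rfl⟩
        exact hp (φ.map_target (hrt hz).1)
      · convert AnalyticDescribed.pos (I := 𝓡 n) (fun _ => (0 : ℝ)) contMDiffOn_const using 1
        ext q
        simp only [Set.mem_inter_iff, Set.mem_compl_iff, lt_irrefl, Set.mem_ofPred_eq, and_false,
          iff_false]
        exact fun h => h.2 (hVK h.1)
  refine ⟨V, ⟨hVo, ⟨mem_extChartAt_source x, Metric.mem_ball_self hr⟩, ?_, hVc⟩, ?_⟩
  · intro p
    refine ⟨Set.univ, isOpen_univ, trivial, 0, Prod.fst ⁻¹' V, hVs.preimage contMDiff_fst, ?_, ?_⟩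
    · refine (hVc.prod (isCompact_singleton (x := (0 : EuclideanSpace ℝ (Fin 0))))).closure_of_subset
        fun y hy => ⟨subset_closure hy, Subsingleton.elim _ _⟩
    · rw [Set.image_preimage_eq _ fun y => ⟨(y, 0), rfl⟩]
  · intro y hy
    obtain ⟨z, hz, rfl⟩ := hVK hy
    exact (hrt hz).2

end Subanalytic

section Opens

variable {X : Type u} {S : Type v} [TopologicalSpace X] [TopologicalSpace S]

/-- The open subset `U × V` of `X × S`. -/
def rect (U : Opens X) (V : Opens S) : Opens (X × S) :=
  ⟨(U : Set X) ×ˢ (V : Set S), U.isOpen.prod V.isOpen⟩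

variable (n d : ℕ) (X S)
variable [ChartedSpace (EuclideanSpace ℝ (Fin n)) X] [ChartedSpace (EuclideanSpace ℝ (Fin d)) S]

/-- The family `𝒯` of the products `U × V` of relatively compact subanalytic open subsets. -/
def basicRects : Set (Opens (X × S)) :=
  {Q | ∃ (U : Opens X) (V : Opens S),
    (IsSubanalytic n (U : Set X) ∧ IsCompact (closure (U : Set X))) ∧
    (IsSubanalytic d (V : Set S) ∧ IsCompact (closure (V : Set S))) ∧ Q = rect U V}

/-- `W` is a locally finite union (in `X × S`) of elements of `𝒯`. -/
def IsBisubanalytic (W : Opens (X × S)) : Prop :=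
  ∃ 𝒬 : Set (Opens (X × S)), 𝒬 ⊆ basicRects X S n d ∧
    LocallyFinite (fun Q : 𝒬 => ((Q : Opens (X × S)) : Set (X × S))) ∧ W = sSup 𝒬

/-- `W` is a finite union of products `U × V` with `U` subanalytic open and `V` open. -/
def IsRelSubanalytic (W : Opens (X × S)) : Prop :=
  ∃ 𝒬 : Set (Opens (X × S)), 𝒬.Finite ∧
    (∀ Q ∈ 𝒬, ∃ (U : Opens X) (V : Opens S), IsSubanalytic n (U : Set X) ∧ Q = rect U V) ∧
    W = sSup 𝒬

/-- The category `op(X_sa × S_sa)`: morphisms are inclusions. -/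
abbrev SaSa : Type (max u v) := {W : Opens (X × S) // IsBisubanalytic X S n d W}

/-- The category `op(X_sa × S)`: morphisms are inclusions. -/
abbrev SaTop : Type (max u v) := {W : Opens (X × S) // IsRelSubanalytic X S n W}

variable {n d X S}

/-- `U × V` as an object of `X_sa × S`. -/
def SaTop.rect (U : Opens X) (hU : IsSubanalytic n (U : Set X)) (V : Opens S) : SaTop X S n :=
  ⟨RelSub.rect U V, {RelSub.rect U V}, Set.finite_singleton _, by
    rintro _ rfl; exact ⟨U, V, hU, rfl⟩, by simp⟩

theorem rect_inf (U U' : Opens X) (V V' : Opens S) :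
    rect U V ⊓ rect U' V' = rect (U ⊓ U') (V ⊓ V') := by
  ext x
  simp only [rect, Opens.coe_inf, Opens.coe_mk, Set.mem_inter_iff, Set.mem_prod]
  tauto

theorem basicRects_inf [T2Space X] [T2Space S] [IsManifold (𝓡 n) ω X] [IsManifold (𝓡 d) ω S]
    {Q Q' : Opens (X × S)} (h : Q ∈ basicRects X S n d) (h' : Q' ∈ basicRects X S n d) :
    Q ⊓ Q' ∈ basicRects X S n d := by
  obtain ⟨U, V, hU, hV, rfl⟩ := h
  obtain ⟨U', V', hU', hV', rfl⟩ := h'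
  exact ⟨U ⊓ U', V ⊓ V', ⟨hU.1.inter hU'.1, hU.2.closure_of_subset
    (Set.inter_subset_left.trans subset_closure)⟩, ⟨hV.1.inter hV'.1, hV.2.closure_of_subset
    (Set.inter_subset_left.trans subset_closure)⟩, rect_inf _ _ _ _⟩

theorem isBisubanalytic_iSup {ι : Type*} (f : ι → Opens (X × S))
    (hf : ∀ i, f i ∈ basicRects X S n d) (hl : LocallyFinite fun i => (f i : Set (X × S))) :
    IsBisubanalytic X S n d (⨆ i, f i) := by
  refine ⟨Set.range f, by rintro _ ⟨i, rfl⟩; exact hf i, ?_, rfl⟩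
  refine hl.on_range.comp_injective
    (g := fun Q : Set.range f => ⟨(Q.1 : Set (X × S)), by
      obtain ⟨i, hi⟩ := Q.2; exact ⟨i, by rw [← hi]⟩⟩) ?_
  intro Q Q' h
  exact Subtype.ext (SetLike.coe_injective (Subtype.ext_iff.1 h))

theorem isBisubanalytic_of_mem {Q : Opens (X × S)} (h : Q ∈ basicRects X S n d) :
    IsBisubanalytic X S n d Q := by
  simpa using isBisubanalytic_iSup (fun _ : Unit => Q) (fun _ => h) (locallyFinite_of_finite _)

theorem IsBisubanalytic.inf [T2Space X] [T2Space S] [IsManifold (𝓡 n) ω X]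
    [IsManifold (𝓡 d) ω S] {W W' : Opens (X × S)}
    (h : IsBisubanalytic X S n d W) (h' : IsBisubanalytic X S n d W') :
    IsBisubanalytic X S n d (W ⊓ W') := by
  obtain ⟨𝒬, hQ, hl, rfl⟩ := h
  obtain ⟨𝒬', hQ', hl', rfl⟩ := h'
  have := isBisubanalytic_iSup (n := n) (d := d) (fun p : 𝒬 × 𝒬' => p.1.1 ⊓ p.2.1)
    (fun p => basicRects_inf (hQ p.1.2) (hQ' p.2.2)) (by
      intro x
      obtain ⟨t, ht, hf⟩ := hl x
      obtain ⟨t', ht', hf'⟩ := hl' x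
      refine ⟨t ∩ t', Filter.inter_mem ht ht', (hf.prod hf').subset ?_⟩
      rintro p ⟨y, hy, hy'⟩
      exact ⟨⟨y, hy.1, hy'.1⟩, ⟨y, hy.2, hy'.2⟩⟩)
  convert this using 1
  ext x
  simp only [Opens.coe_inf, Opens.coe_sSup, Opens.coe_iSup, Set.mem_inter_iff, Set.mem_iUnion]
  constructor
  · rintro ⟨⟨Q, hq, h⟩, ⟨Q', hq', h'⟩⟩
    exact ⟨(⟨Q, hq⟩, ⟨Q', hq'⟩), h, h'⟩
  · rintro ⟨p, h, h'⟩
    exact ⟨⟨p.1, p.1.2, h⟩, ⟨p.2, p.2.2, h'⟩⟩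

/-- Relatively compact subanalytic open sets form a locally finite covering of a manifold. -/
theorem exists_locallyFinite_subanalytic (X : Type u) [TopologicalSpace X]
    [ChartedSpace (EuclideanSpace ℝ (Fin n)) X]
    [T2Space X] [SecondCountableTopology X] [IsManifold (𝓡 n) ω X] :
    ∃ (α : Type u) (f : α → Opens X), (∀ a, IsSubanalytic n (f a : Set X) ∧
      IsCompact (closure (f a : Set X))) ∧ ⨆ a, f a = ⊤ ∧
      LocallyFinite fun a => (f a : Set X) := by
  have : LocallyCompactSpace X := ChartedSpace.locallyCompactSpace (EuclideanSpace ℝ (Fin n)) X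
  obtain ⟨α, c, r, h1, h2, h3⟩ := refinement_of_locallyCompact_sigmaCompact_of_nhds_basis
    (fun x : X => hasBasis_subanalytic (n := n) x)
  exact ⟨α, fun a => ⟨r a, (h1 a).1⟩, fun a => ⟨(h1 a).2.2.1, (h1 a).2.2.2⟩,
    Opens.ext (by simpa using h2), h3⟩

/-- `U × V'`, with `U` and `V'` subanalytic and `V'` relatively compact, as an object of
`X_sa × S_sa`. -/
def SaSa.rect [T2Space X] [T2Space S] [SecondCountableTopology X] [IsManifold (𝓡 n) ω X]
    (U : Opens X) (hU : IsSubanalytic n (U : Set X))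
    (V' : Opens S) (hV' : IsSubanalytic d (V' : Set S)) (hV'c : IsCompact (closure (V' : Set S))) :
    SaSa X S n d :=
  ⟨RelSub.rect U V', by
    obtain ⟨α, f, hf, htop, hl⟩ := exists_locallyFinite_subanalytic (n := n) X
    have := isBisubanalytic_iSup (n := n) (d := d) (fun a => RelSub.rect (U ⊓ f a) V')
      (fun a => ⟨U ⊓ f a, V', ⟨hU.inter (hf a).1, (hf a).2.closure_of_subset
        (Set.inter_subset_right.trans subset_closure)⟩, ⟨hV', hV'c⟩, rfl⟩)
      ((hl.subset fun a => Set.inter_subset_right).prod_right _)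
    convert this using 1
    ext x
    have hx : x.1 ∈ ⨆ a, f a := by rw [htop]; trivial
    rw [Opens.mem_iSup] at hx
    obtain ⟨a, ha⟩ := hx
    simp only [RelSub.rect, Opens.coe_iSup, Opens.coe_mk, Opens.coe_inf, Set.mem_iUnion,
      Set.mem_prod, Set.mem_inter_iff]
    exact ⟨fun h => ⟨a, ⟨h.1, ha⟩, h.2⟩, fun ⟨_, h, h'⟩ => ⟨h.1, h'⟩⟩⟩

end Opens

section Topologies

variable {n d : ℕ} {X : Type u} {S : Type v} [TopologicalSpace X] [TopologicalSpace S]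
  [ChartedSpace (EuclideanSpace ℝ (Fin n)) X] [ChartedSpace (EuclideanSpace ℝ (Fin d)) S]

/-- The coverings of `U` in the subanalytic site `X_sa`: families `𝒰` of subanalytic open subsets
of `U` such that every compact `K` admits a finite subfamily `𝒰₀` with `K ∩ ⋃ 𝒰₀ = K ∩ U`. -/
def IsSaCovering (n : ℕ) {X : Type u} [TopologicalSpace X]
    [ChartedSpace (EuclideanSpace ℝ (Fin n)) X] (U : Opens X) (𝒰 : Set (Opens X)) : Prop :=
  (∀ U' ∈ 𝒰, IsSubanalytic n (U' : Set X) ∧ U' ≤ U) ∧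
  ∀ K : Set X, IsCompact K → ∃ 𝒰₀ ⊆ 𝒰, 𝒰₀.Finite ∧
    K ∩ ((sSup 𝒰₀ : Opens X) : Set X) = K ∩ (U : Set X)

variable (n d X S)

/-- The Grothendieck topology of `X_sa × S_sa`: a sieve on `W` is covering if for any `Q ∈ 𝒯`
contained in `W`, finitely many of its members cover `Q`. -/
def saSaTopology [T2Space X] [T2Space S] [IsManifold (𝓡 n) ω X] [IsManifold (𝓡 d) ω S] :
    GrothendieckTopology (SaSa X S n d) where
  sieves W := {R | ∀ Q ∈ basicRects X S n d, Q ≤ W.1 → ∃ t : Set (SaSa X S n d), t.Finite ∧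
    (∀ Z ∈ t, ∃ h : Z ≤ W, R.arrows (homOfLE h)) ∧ (Q : Set (X × S)) ⊆ ⋃ Z ∈ t, (Z.1 : Set (X × S))}
  top_mem' W Q _ hQW := ⟨{W}, Set.finite_singleton _, by rintro _ rfl; exact ⟨le_rfl, trivial⟩,
    by simpa using hQW⟩
  pullback_stable' := by
    intro W W' R f hR Q hQ hQW
    obtain ⟨t, ht, htR, hc⟩ := hR Q hQ (hQW.trans (leOfHom f))
    let g : SaSa X S n d → SaSa X S n d := fun Z => ⟨Z.1 ⊓ W'.1, Z.2.inf W'.2⟩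
    refine ⟨g '' t, ht.image g, ?_, ?_⟩
    · rintro _ ⟨Z, hZ, rfl⟩
      obtain ⟨h, hR'⟩ := htR Z hZ
      exact ⟨inf_le_right (a := Z.1), R.downward_closed hR' (homOfLE (inf_le_left (a := Z.1)))⟩
    · intro x hx
      obtain ⟨Z, hZ, hxZ⟩ := Set.mem_iUnion₂.1 (hc hx)
      exact Set.mem_iUnion₂.2 ⟨g Z, ⟨Z, hZ, rfl⟩, hxZ, hQW hx⟩
  transitive' := by
    intro W R hR R' hR' Q hQ hQW
    obtain ⟨t, ht, htR, hc⟩ := hR Q hQ hQW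
    have hQc : IsCompact (closure (Q : Set (X × S))) := by
      obtain ⟨U, V, hU, hV, rfl⟩ := hQ
      simpa [rect, closure_prod_eq] using hU.2.prod hV.2
    have key : ∀ Z ∈ t, ∃ t' : Set (SaSa X S n d), t'.Finite ∧
        (∀ Y ∈ t', ∃ h : Y ≤ W, R'.arrows (homOfLE h)) ∧
        (Q : Set (X × S)) ∩ Z.1 ⊆ ⋃ Y ∈ t', (Y.1 : Set (X × S)) := by
      intro Z hZ
      obtain ⟨h, hRZ⟩ := htR Z hZ
      obtain ⟨𝒬, h𝒬, hl, hZ𝒬⟩ := Z.2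
      have hfin := hl.finite_nonempty_inter_compact hQc
      have : ∀ P : 𝒬, ∃ t' : Set (SaSa X S n d), t'.Finite ∧
          (∀ Y ∈ t', ∃ h : Y ≤ W, R'.arrows (homOfLE h)) ∧
          ((P : Opens (X × S)) : Set (X × S)) ⊆ ⋃ Y ∈ t', (Y.1 : Set (X × S)) := by
        intro P
        obtain ⟨t', h1, h2, h3⟩ := hR' hRZ P.1 (h𝒬 P.2) (hZ𝒬 ▸ le_sSup P.2)
        exact ⟨t', h1, fun Y hY => by
          obtain ⟨h', hh⟩ := h2 Y hY
          exact ⟨h'.trans h, hh⟩, h3⟩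
      choose T hT1 hT2 hT3 using this
      refine ⟨⋃ P ∈ {P : 𝒬 | ((P.1 : Set (X × S)) ∩ closure (Q : Set (X × S))).Nonempty}, T P,
        hfin.biUnion fun P _ => hT1 P, ?_, ?_⟩
      · intro Y hY
        obtain ⟨P, _, hP⟩ := Set.mem_iUnion₂.1 hY
        exact hT2 P Y hP
      · rintro x ⟨hxQ, hxZ⟩
        rw [hZ𝒬] at hxZ
        obtain ⟨P, hP, hxP⟩ := Opens.mem_sSup.1 hxZ
        obtain ⟨Y, hY, hxY⟩ := Set.mem_iUnion₂.1 (hT3 ⟨P, hP⟩ hxP)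
        exact Set.mem_iUnion₂.2 ⟨Y, Set.mem_iUnion₂.2 ⟨⟨P, hP⟩, ⟨x, hxP, subset_closure hxQ⟩, hY⟩,
          hxY⟩
    choose! T hT1 hT2 hT3 using key
    refine ⟨⋃ Z ∈ t, T Z, ht.biUnion hT1, ?_, ?_⟩
    · intro Y hY
      obtain ⟨Z, hZ, h⟩ := Set.mem_iUnion₂.1 hY
      exact hT2 Z hZ Y h
    · intro x hx
      obtain ⟨Z, hZ, hxZ⟩ := Set.mem_iUnion₂.1 (hc hx)
      obtain ⟨Y, hY, hxY⟩ := Set.mem_iUnion₂.1 (hT3 Z hZ ⟨hx, hxZ⟩)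
      exact Set.mem_iUnion₂.2 ⟨Y, Set.mem_iUnion₂.2 ⟨Z, hZ, hY⟩, hxY⟩

variable {n X S} in
/-- The sieve on `U × V` generated by the products `U' × V'`, `U' ∈ 𝒰`, `V' ∈ 𝒱`. -/
def productSieve (U : Opens X) (hU : IsSubanalytic n (U : Set X)) (V : Opens S)
    (𝒰 : Set (Opens X)) (h𝒰 : IsSaCovering n U 𝒰) (𝒱 : Set (Opens S)) :
    Sieve (SaTop.rect U hU V) :=
  Sieve.ofObjects (fun p : 𝒰 × 𝒱 => SaTop.rect p.1.1 (h𝒰.1 _ p.1.2).1 p.2.1) _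

/-- The Grothendieck topology of `X_sa × S`, generated by the following coverings:
a family covers `U × V` if it is refined by some `{U' × V'}` with `{U'}` a covering of `U` in `X_sa`
and `{V'}` an open covering of `V`; a family covers `W` if its restriction to every
`U × V` contained in `W` is a covering. -/
def saTopTopology : GrothendieckTopology (SaTop X S n) :=
  sInf {J | (∀ (U : Opens X) (hU : IsSubanalytic n (U : Set X)) (V : Opens S)
      (𝒰 : Set (Opens X)) (h𝒰 : IsSaCovering n U 𝒰) (𝒱 : Set (Opens S)), sSup 𝒱 = V →
        productSieve U hU V 𝒰 h𝒰 𝒱 ∈ J (SaTop.rect U hU V)) ∧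
    (∀ (W : SaTop X S n) (R : Sieve W),
      (∀ (U : Opens X) (hU : IsSubanalytic n (U : Set X)) (V : Opens S)
        (h : SaTop.rect U hU V ≤ W), R.pullback (homOfLE h) ∈ J (SaTop.rect U hU V)) → R ∈ J W)}

end Topologies

section Explicit

variable {n : ℕ} {X : Type u} {S : Type v} [TopologicalSpace X] [TopologicalSpace S]
  [ChartedSpace (EuclideanSpace ℝ (Fin n)) X]

variable (n X S) in
/-- Another description of `saTopTopology`, see `saTopTopology_eq`: a sieve on `W` is covering if for
any `U × V` contained in `W`, with `U` relatively compact, and any `s ∈ V`, there are an open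
neighbourhood `N` of `s` in `V` and a finite covering of `U` by subanalytic open sets `U'` such that
the sets `U' × N` belong to the sieve. -/
def localTopology [T2Space X] : GrothendieckTopology (SaTop X S n) where
  sieves W := {R | ∀ (U : Opens X), IsSubanalytic n (U : Set X) → IsCompact (closure (U : Set X)) →
    ∀ (V : Opens S), rect U V ≤ W.1 → ∀ s ∈ V, ∃ N : Opens S, s ∈ N ∧ N ≤ V ∧
      ∃ 𝒰 : Set (Opens X), 𝒰.Finite ∧ U = sSup 𝒰 ∧ ∀ U' ∈ 𝒰,
        ∃ (hU' : IsSubanalytic n (U' : Set X)) (h : SaTop.rect U' hU' N ≤ W),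
          R.arrows (homOfLE h)}
  top_mem' W U hU _ V hW s hs := ⟨V, hs, le_rfl, {U}, Set.finite_singleton _, by simp, by
    rintro _ rfl; exact ⟨hU, hW, trivial⟩⟩
  pullback_stable' := by
    intro W W' R f hR U hU hUc V hW s hs
    obtain ⟨N, hsN, hNV, 𝒰, hf, rfl, hR'⟩ := hR U hU hUc V (hW.trans (leOfHom f)) s hs
    refine ⟨N, hsN, hNV, 𝒰, hf, rfl, fun U' hU'𝒰 => ?_⟩
    obtain ⟨hU', h, hh⟩ := hR' U' hU'𝒰
    exact ⟨hU', fun y hy => hW (Set.prod_mono (le_sSup hU'𝒰 : U' ≤ sSup 𝒰) hNV hy), hh⟩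
  transitive' := by
    intro W R hR R' hR' U hU hUc V hW s hs
    obtain ⟨N, hsN, hNV, 𝒰, hf, rfl, hRN⟩ := hR U hU hUc V hW s hs
    have : ∀ U' ∈ 𝒰, ∃ N' : Opens S, s ∈ N' ∧ N' ≤ N ∧
      ∃ 𝒰' : Set (Opens X), 𝒰'.Finite ∧ U' = sSup 𝒰' ∧ ∀ U'' ∈ 𝒰',
        ∃ (hU'' : IsSubanalytic n (U'' : Set X)) (h : SaTop.rect U'' hU'' N' ≤ W),
          R'.arrows (homOfLE h) := by
      intro U' hU'𝒰
      obtain ⟨hU', h, hh⟩ := hRN U' hU'𝒰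
      obtain ⟨N', h1, h2, 𝒰', h3, h4, h5⟩ := hR' hh U' hU'
        (hUc.closure_of_subset (fun y hy => subset_closure ((le_sSup hU'𝒰 : U' ≤ sSup 𝒰) hy))) N le_rfl s hsN
      refine ⟨N', h1, h2, 𝒰', h3, h4, fun U'' hU'' => ?_⟩
      obtain ⟨a, b, c⟩ := h5 U'' hU''
      exact ⟨a, b.trans h, c⟩
    choose! N' h1 h2 T h3 h4 h5 using this
    refine ⟨⟨(N : Set S) ∩ ⋂ U' ∈ 𝒰, (N' U' : Set S), N.isOpen.inter
      (hf.isOpen_biInter fun U' _ => (N' U').isOpen)⟩, ⟨hsN, Set.mem_iInter₂.2 h1⟩,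
      fun y hy => hNV hy.1, ⋃ U' ∈ 𝒰, T U', hf.biUnion h3, ?_, ?_⟩
    · apply le_antisymm
      · refine sSup_le fun U' hU' => ?_
        rw [h4 U' hU']
        exact sSup_le_sSup (Set.subset_biUnion_of_mem hU')
      · refine sSup_le fun U'' hU'' => ?_
        obtain ⟨U', hU', hT⟩ := Set.mem_iUnion₂.1 hU''
        exact (le_sSup hT).trans ((h4 U' hU').symm.le.trans (le_sSup hU'))
    · intro U'' hU''
      obtain ⟨U', hU', hT⟩ := Set.mem_iUnion₂.1 hU''
      obtain ⟨a, b, c⟩ := h5 U' hU' U'' hT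
      have hle : SaTop.rect U'' a ⟨(N : Set S) ∩ ⋂ U' ∈ 𝒰, (N' U' : Set S), N.isOpen.inter
          (hf.isOpen_biInter fun U' _ => (N' U').isOpen)⟩ ≤ SaTop.rect U'' a (N' U') :=
        Set.prod_mono_right fun y hy => Set.mem_iInter₂.1 hy.2 U' hU'
      exact ⟨a, hle.trans b, R'.downward_closed c (homOfLE hle)⟩

theorem saTopTopology_eq [T2Space X] [IsManifold (𝓡 n) ω X] :
    saTopTopology n X S = localTopology n X S := by
  apply le_antisymm
  · refine sInf_le ⟨?_, ?_⟩
    · intro U hU V 𝒰 h𝒰 𝒱 h𝒱 U₁ hU₁ hU₁c V₁ hW s hs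
      rcases (U₁ : Set X).eq_empty_or_nonempty with he | ⟨x, hx⟩
      · exact ⟨V₁, hs, le_rfl, ∅, Set.finite_empty, by ext x; simp [he], by simp⟩
      have hle : U₁ ≤ U := fun y hy => (hW (show (y, s) ∈ rect U₁ V₁ from ⟨hy, hs⟩)).1
      have hsV : s ∈ V := (hW (show (x, s) ∈ rect U₁ V₁ from ⟨hx, hs⟩)).2
      rw [← h𝒱] at hsV
      obtain ⟨V', hV', hsV'⟩ := Opens.mem_sSup.1 hsV
      obtain ⟨𝒰₀, hsub, hfin, hK⟩ := h𝒰.2 _ hU₁c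
      refine ⟨V' ⊓ V₁, ⟨hsV', hs⟩, inf_le_right, (fun U' => U₁ ⊓ U') '' 𝒰₀, hfin.image _, ?_, ?_⟩
      · ext y
        have := Set.ext_iff.1 hK y
        simp only [Set.mem_inter_iff, Opens.coe_sSup, Set.mem_iUnion, SetLike.mem_coe,
          exists_prop, Set.mem_image, exists_exists_and_eq_and, Opens.mem_inf] at this ⊢
        constructor
        · intro hy
          obtain ⟨_, U', h1, h2⟩ := this.2 ⟨subset_closure hy, hle hy⟩
          exact ⟨U', h1, hy, h2⟩
        · rintro ⟨U', _, h, _⟩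
          exact h
      · rintro _ ⟨U', hU', rfl⟩
        refine ⟨hU₁.inter (h𝒰.1 U' (hsub hU')).1,
          fun y hy => hW (Set.prod_mono Set.inter_subset_left Set.inter_subset_right hy), ?_⟩
        exact ⟨(⟨U', hsub hU'⟩, ⟨V', hV'⟩),
          ⟨homOfLE (Set.prod_mono Set.inter_subset_right Set.inter_subset_left)⟩⟩
    · intro W R hR U hU hUc V hW s hs
      obtain ⟨N, h1, h2, 𝒰, h3, h4, h5⟩ := hR U hU V hW U hU hUc V le_rfl s hs
      refine ⟨N, h1, h2, 𝒰, h3, h4, fun U' hU' => ?_⟩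
      obtain ⟨a, b, c⟩ := h5 U' hU'
      exact ⟨a, b.trans hW, c⟩
  · refine le_sInf ?_
    rintro J ⟨hJ1, hJ2⟩ W R hR
    refine hJ2 W R fun U hU V hUV => ?_
    have hcov : IsSaCovering n U {U' | (IsSubanalytic n (U' : Set X) ∧ U' ≤ U) ∧
        IsCompact (closure (U' : Set X))} := by
      refine ⟨fun U' h => h.1, fun K hK => ?_⟩
      choose B hB using fun x : X => (hasBasis_subanalytic (n := n) x).ex_mem
      obtain ⟨t, _, htK⟩ := hK.elim_nhds_subcover B fun x _ => (hB x).1.mem_nhds (hB x).2.1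
      refine ⟨(fun x => U ⊓ ⟨B x, (hB x).1⟩) '' t, ?_, t.finite_toSet.image _, ?_⟩
      · rintro _ ⟨x, _, rfl⟩
        exact ⟨⟨hU.inter (hB x).2.2.1, inf_le_left⟩, (hB x).2.2.2.closure_of_subset
          (Set.inter_subset_right.trans subset_closure)⟩
      · ext y
        simp only [Set.mem_inter_iff, Opens.coe_sSup, Set.mem_iUnion, SetLike.mem_coe,
          exists_prop, Set.mem_image, exists_exists_and_eq_and, Opens.mem_inf]
        constructor
        · rintro ⟨hy, x, _, h, _⟩
          exact ⟨hy, h⟩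
        · rintro ⟨hy, h⟩
          obtain ⟨x, hx, hyx⟩ := Set.mem_iUnion₂.1 (htK hy)
          exact ⟨hy, x, hx, h, hyx⟩
    refine J.transitive (hJ1 U hU V _ hcov {V} sSup_singleton) _ ?_
    rintro Z f ⟨⟨⟨U', ⟨hU', hU'U⟩, hU'c⟩, ⟨V', hV'⟩⟩, ⟨g⟩⟩
    obtain rfl : V' = V := hV'
    have hle : SaTop.rect U' hU' V' ≤ W := le_trans (Set.prod_mono_left hU'U) hUV
    suffices h : R.pullback (homOfLE hle) ∈ J _ by
      have := J.pullback_stable g h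
      rw [← Sieve.pullback_comp] at this ⊢
      exact this
    have hone : IsSaCovering n U' {U'} :=
      ⟨by rintro _ rfl; exact ⟨hU', le_rfl⟩, fun K _ => ⟨{U'}, le_rfl, Set.finite_singleton _,
        by simp⟩⟩
    refine J.transitive (hJ1 U' hU' V' _ hone {N | N ≤ V' ∧
      ∃ 𝒰 : Set (Opens X), 𝒰.Finite ∧ U' = sSup 𝒰 ∧ ∀ U'' ∈ 𝒰,
        ∃ (hU' : IsSubanalytic n (U'' : Set X)) (h : SaTop.rect U'' hU' N ≤ W),
          R.arrows (homOfLE h)} ?_) _ ?_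
    · apply le_antisymm
      · exact sSup_le fun N hN => hN.1
      · intro s hs
        obtain ⟨N, h1, h2, h3⟩ := hR U' hU' hU'c V' hle s hs
        exact Opens.mem_sSup.2 ⟨N, ⟨h2, h3⟩, h1⟩
    rintro Z' f' ⟨⟨⟨U₁, hU₁⟩, ⟨N, hNV, 𝒰, hfin, he, hR'⟩⟩, ⟨g'⟩⟩
    obtain rfl : U₁ = U' := hU₁
    have hle' : SaTop.rect U₁ hU' N ≤ W := le_trans (Set.prod_mono_right hNV) hle
    suffices h : R.pullback (homOfLE hle') ∈ J _ by
      have := J.pullback_stable g' h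
      rw [← Sieve.pullback_comp] at this ⊢
      exact this
    have hcov' : IsSaCovering n U₁ 𝒰 := ⟨fun U'' h => ⟨(hR' U'' h).1, he ▸ le_sSup h⟩,
      fun K _ => ⟨𝒰, le_rfl, hfin, by rw [he]⟩⟩
    refine J.superset_covering ?_ (hJ1 U₁ hU' N 𝒰 hcov' {N} (by simp))
    rintro Y k ⟨⟨⟨U'', hU''⟩, ⟨_, rfl⟩⟩, ⟨l⟩⟩
    obtain ⟨a, b, c⟩ := hR' U'' hU''
    exact R.downward_closed c l

end Explicit

/-- On a site whose objects are ordered by inclusion: `V ⊆ U` is weakly quasi-compact in `U` if the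
restriction to `V` of every covering of `U` admits a finite refinement which covers `V`. -/
def IsWeaklyQuasiCompact {C : Type w} [Preorder C] (J : GrothendieckTopology C) {V U : C}
    (h : V ≤ U) : Prop :=
  ∀ R ∈ J U, ∃ t : Set C, t.Finite ∧
    (∀ Z ∈ t, ∃ hZ : Z ≤ V, (R.pullback (homOfLE h)).arrows (homOfLE hZ)) ∧
    Sieve.ofObjects (fun Z : t => (Z : C)) V ∈ J V

instance forget_preservesFilteredColimits :
    PreservesFilteredColimitsOfSize.{w, w} (forget (ModuleCat.{w} ℂ)) :=
  comp_preservesFilteredColimits (forget₂ (ModuleCat.{w} ℂ) AddCommGrpCat.{w})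
    (forget AddCommGrpCat.{w})

noncomputable section InverseImage

variable {n d : ℕ} {X : Type u} {S : Type v} [TopologicalSpace X] [TopologicalSpace S]
  [ChartedSpace (EuclideanSpace ℝ (Fin n)) X] [ChartedSpace (EuclideanSpace ℝ (Fin d)) S]

variable (n d X S) in
/-- The inclusion of `op(X_sa × S_sa)` into the open subsets of `X × S`. -/
def saSaInclusion : SaSa X S n d ⥤ Opens (X × S) :=
  Monotone.functor (f := Subtype.val) fun _ _ h => h

variable (n X S) in
/-- The inclusion of `op(X_sa × S)` into the open subsets of `X × S`. -/
def saTopInclusion : SaTop X S n ⥤ Opens (X × S) :=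
  Monotone.functor (f := Subtype.val) fun _ _ h => h

variable [T2Space X] [T2Space S] [IsManifold (𝓡 n) ω X] [IsManifold (𝓡 d) ω S]

/-- Sheaves of complex vector spaces on `X_sa × S_sa`. -/
abbrev SaSaSheaf (n d : ℕ) (X : Type u) (S : Type v) [TopologicalSpace X] [TopologicalSpace S]
    [ChartedSpace (EuclideanSpace ℝ (Fin n)) X] [ChartedSpace (EuclideanSpace ℝ (Fin d)) S]
    [T2Space X] [T2Space S] [IsManifold (𝓡 n) ω X] [IsManifold (𝓡 d) ω S] :=
  Sheaf (saSaTopology n d X S) (ModuleCat.{max u v} ℂ)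

/-- The presheaf `W ↦ colim F(W')` on `X_sa × S`, where `W'` runs over the objects of
`X_sa × S_sa` containing `W`. -/
def preInverseImage (F : SaSaSheaf n d X S) : (SaTop X S n)ᵒᵖ ⥤ ModuleCat.{max u v} ℂ :=
  (saTopInclusion n X S).op ⋙ (saSaInclusion n d X S).op.lan.obj F.obj

/-- The inverse image `a⁻¹F` on `X_sa × S` of a sheaf `F` on `X_sa × S_sa`: the sheaf associated
with `preInverseImage F`. -/
def inverseImage (F : SaSaSheaf n d X S) :
    Sheaf (saTopTopology n X S) (ModuleCat.{max u v} ℂ) :=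
  (presheafToSheaf (saTopTopology n X S) (ModuleCat.{max u v} ℂ)).obj (preInverseImage F)

/-- The canonical morphism `Γ(W; F) → Γ(W; a⁻¹F)`, for `W` an object of both sites. -/
def toInverseImage (F : SaSaSheaf n d X S) (W : Opens (X × S)) (h : IsBisubanalytic X S n d W)
    (h' : IsRelSubanalytic X S n W) :
    F.obj.obj (op ⟨W, h⟩) ⟶ (inverseImage F).obj.obj (op ⟨W, h'⟩) :=
  ((saSaInclusion n d X S).op.lanUnit.app F.obj).app (op ⟨W, h⟩) ≫
    (toSheafify (saTopTopology n X S) (preInverseImage F)).app (op ⟨W, h'⟩)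

/-- The subanalytic open subsets `V' ⊂⊂ V`. -/
abbrev RelCompactSubanalytic (d : ℕ) {S : Type v} [TopologicalSpace S]
    [ChartedSpace (EuclideanSpace ℝ (Fin d)) S] (V : Opens S) : Type v :=
  {V' : Opens S // IsSubanalytic d (V' : Set S) ∧ IsCompact (closure (V' : Set S)) ∧
    closure (V' : Set S) ⊆ V}

/-- The projective system `V' ↦ Γ(U × V'; F)`, `V' ⊂⊂ V` subanalytic. -/
def rectSystem [SecondCountableTopology X] (F : SaSaSheaf n d X S) (U : Opens X)
    (hU : IsSubanalytic n (U : Set X)) (V : Opens S) :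
    (RelCompactSubanalytic d V)ᵒᵖ ⥤ ModuleCat.{max u v} ℂ :=
  (Monotone.functor (f := fun V' : RelCompactSubanalytic d V =>
    SaSa.rect (n := n) U hU V'.1 V'.2.1 V'.2.2.1) fun _ _ h => Set.prod_mono_right h).op ⋙ F.obj

variable (d) in
/-- The objects `W'` of `X_sa × S_sa` that are weakly quasi-compact in `W` (on `X_sa × S`). -/
abbrev WeaklyQuasiCompactIn (W : SaTop X S n) : Type (max u v) :=
  {W' : SaTop X S n // IsBisubanalytic X S n d W'.1 ∧
    ∃ h : W' ≤ W, IsWeaklyQuasiCompact (saTopTopology n X S) h}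

/-- The projective system `W' ↦ Γ(W'; F)`, `W'` weakly quasi-compact in `W`. -/
def wqcSystem (F : SaSaSheaf n d X S) (W : SaTop X S n) :
    (WeaklyQuasiCompactIn d W)ᵒᵖ ⥤ ModuleCat.{max u v} ℂ :=
  (Monotone.functor (f := fun W' : WeaklyQuasiCompactIn d W =>
    (⟨W'.1.1, W'.2.1⟩ : SaSa X S n d)) fun _ _ h => h).op ⋙ F.obj

end InverseImage

end RelSub

/-! Over a relatively compact `U`, the coverings of `X_sa × S` are finite in the direction of `X`,
but only local in the direction of `S`. They become finite on a subset covered by finitely many `U ×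
C ⊆ W` with `U` relatively compact subanalytic and `C` compact; such a subset is called inner
(`IsInner`). By `exists_finite_refinement`, every covering of `W` is refined over an inner subset by
finitely many rectangles `U_p × N_p`, and the smaller `U_p × M_p` with `M_p ⊂⊂ N_p` still cover it.
Finite unions are coverings in `X_sa × S_sa`, so `F` can be glued along such families.

This controls the map from sections of `F` to sections of `a⁻¹F`. If `y` dies in `Γ(Z; a⁻¹F)`, it
vanishes on neighbourhoods of the members of a covering of `Z`. Finitely many of these cover any
object inner in `Z`, so `y` vanishes there (`res_eq_zero_of_isInner`). Conversely, a section `α`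
over `W` is represented by sections of `F` on sets containing the `U_p × N_p`. After restriction to
the `U_p × M_p` they agree on overlaps, because those overlaps are inner in the corresponding
overlaps of the larger rectangles. They glue to a representative of `α` near any given inner subset
(`exists_canonical_eq_of_isInner`). Hence `α` yields a compatible family of sections over all inner
objects (`exists_innerSections`).

For (b), weakly quasi-compact means inner (`isWeaklyQuasiCompact_iff`). For (a), `U × V'` need not
be inner when `U` is not relatively compact. But the products `U' × V'` with `U' ⊆ U` relatively
compact are inner and cover `U × V'` in `X_sa × S_sa`, so families over them glue. The passage to
the projective limit is common to both cases: `exists_limit_iso`. -/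

namespace RelSub

/-! ### Restriction, separation and gluing for sheaves on a preorder -/

section Restriction

variable {C : Type w} [Preorder C]

/-- The restriction morphisms of a presheaf of complex vector spaces on a preorder. -/
def res (G : Cᵒᵖ ⥤ ModuleCat.{w} ℂ) {a b : C} (h : a ≤ b) :
    G.obj (op b) →ₗ[ℂ] G.obj (op a) :=
  (G.map (homOfLE h).op).hom

theorem res_res (G : Cᵒᵖ ⥤ ModuleCat.{w} ℂ) {a b c : C} (h : a ≤ b) (h' : b ≤ c)
    (x : G.obj (op c)) : res G h (res G h' x) = res G (h.trans h') x := by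
  simp only [res, ← LinearMap.comp_apply, ← ModuleCat.hom_comp, ← G.map_comp]
  rfl

theorem res_rfl (G : Cᵒᵖ ⥤ ModuleCat.{w} ℂ) {a : C} (h : a ≤ a)
    (x : G.obj (op a)) : res G h x = x := by
  change (G.map (𝟙 _)).hom x = x
  rw [G.map_id]
  rfl

variable {J : GrothendieckTopology C} {G : Cᵒᵖ ⥤ ModuleCat.{w} ℂ}

theorem isSheaf_forget (hG : Presheaf.IsSheaf J G) :
    Presieve.IsSheaf J (G ⋙ forget (ModuleCat.{w} ℂ)) :=
  (isSheaf_iff_isSheaf_of_type _ _).1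
    ((Presheaf.isSheaf_iff_isSheaf_forget J G (forget (ModuleCat.{w} ℂ))).1 hG)

theorem eq_of_res_eq (hG : Presheaf.IsSheaf J G) {W : C} {R : Sieve W} (hR : R ∈ J W)
    {x y : G.obj (op W)}
    (h : ∀ (Z : C) (hZ : Z ≤ W), R.arrows (homOfLE hZ) → res G hZ x = res G hZ y) : x = y :=
  (isSheaf_forget hG R hR).isSeparatedFor.ext (t₁ := x) (t₂ := y) fun Z f hf =>
    h Z (leOfHom f) hf

theorem eq_of_res_eq_of_cover (hG : Presheaf.IsSheaf J G) {W : C} {ι : Type*} {Z : ι → C}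
    (hZ : ∀ i, Z i ≤ W) (hJ : Sieve.ofObjects Z W ∈ J W) {x y : G.obj (op W)}
    (h : ∀ i, res G (hZ i) x = res G (hZ i) y) : x = y :=
  eq_of_res_eq hG hJ fun T hT ⟨i, ⟨f⟩⟩ => by
    rw [← res_res G (leOfHom f) (hZ i), h, res_res]

/-- The sheaf condition in terms of an indexed family. Since `C` is not assumed to have meets,
compatibility is tested on every common lower bound of `Z i` and `Z j`. -/
theorem exists_glue (hG : Presheaf.IsSheaf J G) {W : C} {ι : Type*} {Z : ι → C}
    (hZ : ∀ i, Z i ≤ W) (hJ : Sieve.ofObjects Z W ∈ J W) (x : ∀ i, G.obj (op (Z i)))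
    (h : ∀ i j T (hi : T ≤ Z i) (hj : T ≤ Z j), res G hi (x i) = res G hj (x j)) :
    ∃ y : G.obj (op W), ∀ i, res G (hZ i) y = x i := by
  let fam : Presieve.FamilyOfElements (G ⋙ forget (ModuleCat.{w} ℂ))
      (Sieve.ofObjects Z W).arrows := fun T f hf =>
    res G (leOfHom hf.choose_spec.some) (x hf.choose)
  have hfam : fam.Compatible := by
    intro T₁ T₂ T g₁ g₂ f₁ f₂ h₁ h₂ e
    change res G (leOfHom g₁) (res G _ _) = res G (leOfHom g₂) (res G _ _)
    rw [res_res, res_res]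
    exact h _ _ _ _ _
  obtain ⟨y, hy, _⟩ := isSheaf_forget hG _ hJ fam hfam
  refine ⟨y, fun i => ?_⟩
  have h1 : res G (hZ i) y = _ := hy (homOfLE (hZ i)) ⟨i, ⟨𝟙 _⟩⟩
  rw [h1]
  -- The family uses some chosen index through which `Z i` factors; compatibility trades it for `i`
  -- itself.
  exact (h _ i _ _ le_rfl).trans (res_rfl G _ _)

end Restriction

/-! ### Sections of the inverse image: Kan extension and sheafification -/

noncomputable section Canonical

variable {n d : ℕ} {X : Type u} {S : Type v} [TopologicalSpace X] [TopologicalSpace S]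
  [ChartedSpace (EuclideanSpace ℝ (Fin n)) X] [ChartedSpace (EuclideanSpace ℝ (Fin d)) S]
  [T2Space X] [T2Space S] [IsManifold (𝓡 n) ω X] [IsManifold (𝓡 d) ω S]

/-- The canonical map from `Γ(Y; F)` to the left Kan extension of `F` along the inclusion. -/
def lanUnitMap (F : SaSaSheaf n d X S) (Y : SaSa X S n d) :
    F.obj.obj (op Y) →ₗ[ℂ] ((saSaInclusion n d X S).op.lan.obj F.obj).obj (op Y.1) :=
  (((saSaInclusion n d X S).op.lanUnit.app F.obj).app (op Y)).hom

theorem lanUnitMap_res (F : SaSaSheaf n d X S) {Y Y' : SaSa X S n d} (h : Y' ≤ Y)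
    (y : F.obj.obj (op Y)) :
    lanUnitMap F Y' (res F.obj h y) =
      res ((saSaInclusion n d X S).op.lan.obj F.obj) (show Y'.1 ≤ Y.1 from h)
        (lanUnitMap F Y y) :=
  congr($(((saSaInclusion n d X S).op.lanUnit.app F.obj).naturality (homOfLE h).op).hom y)

/-- The canonical map `Γ(Y; F) → colim Γ(W'; F)`, for `Z ⊆ Y`. -/
def toPreInverseImage (F : SaSaSheaf n d X S) {Y : SaSa X S n d} {Z : SaTop X S n}
    (h : Z.1 ≤ Y.1) : F.obj.obj (op Y) →ₗ[ℂ] (preInverseImage F).obj (op Z) :=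
  res ((saSaInclusion n d X S).op.lan.obj F.obj) h ∘ₗ lanUnitMap F Y

/-- The canonical map `Γ(Y; F) → Γ(Z; a⁻¹F)`, for `Z ⊆ Y`. -/
def canonical (F : SaSaSheaf n d X S) {Y : SaSa X S n d} {Z : SaTop X S n}
    (h : Z.1 ≤ Y.1) : F.obj.obj (op Y) →ₗ[ℂ] (inverseImage F).obj.obj (op Z) :=
  ((toSheafify (saTopTopology n X S) (preInverseImage F)).app (op Z)).hom ∘ₗ
    toPreInverseImage F h

theorem res_toPreInverseImage (F : SaSaSheaf n d X S) {Y : SaSa X S n d} {Z Z' : SaTop X S n}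
    (h : Z.1 ≤ Y.1) (h' : Z' ≤ Z) (y : F.obj.obj (op Y)) :
    res (preInverseImage F) h' (toPreInverseImage F h y) =
      toPreInverseImage F (le_trans (show Z'.1 ≤ Z.1 from h') h) y :=
  res_res ((saSaInclusion n d X S).op.lan.obj F.obj) (show Z'.1 ≤ Z.1 from h') h _

theorem toPreInverseImage_res (F : SaSaSheaf n d X S) {Y Y' : SaSa X S n d} {Z : SaTop X S n}
    (h : Z.1 ≤ Y'.1) (h' : Y' ≤ Y) (y : F.obj.obj (op Y)) :
    toPreInverseImage F h (res F.obj h' y) =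
      toPreInverseImage F (h.trans h' : Z.1 ≤ Y.1) y := by
  change res _ h (lanUnitMap F Y' _) = res _ _ (lanUnitMap F Y y)
  rw [lanUnitMap_res, res_res]

theorem res_canonical (F : SaSaSheaf n d X S) {Y : SaSa X S n d} {Z Z' : SaTop X S n}
    (h : Z.1 ≤ Y.1) (h' : Z' ≤ Z) (y : F.obj.obj (op Y)) :
    res (inverseImage F).obj h' (canonical F h y) =
      canonical F (le_trans (show Z'.1 ≤ Z.1 from h') h) y := by
  have := (toSheafify (saTopTopology n X S) (preInverseImage F)).naturality (homOfLE h').op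
  have := congr($(this).hom (toPreInverseImage F h y))
  refine this.symm.trans ?_
  exact congrArg _ (res_toPreInverseImage F h h' y)

theorem canonical_res (F : SaSaSheaf n d X S) {Y Y' : SaSa X S n d} {Z : SaTop X S n}
    (h : Z.1 ≤ Y'.1) (h' : Y' ≤ Y) (y : F.obj.obj (op Y)) :
    canonical F h (res F.obj h' y) = canonical F (h.trans h' : Z.1 ≤ Y.1) y :=
  congrArg _ (toPreInverseImage_res F h h' y)

/-- The two sides differ only by a restriction along an identity in the Kan extension. -/
theorem toInverseImage_apply (F : SaSaSheaf n d X S) (W : Opens (X × S))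
    (h : IsBisubanalytic X S n d W) (h' : IsRelSubanalytic X S n W)
    (y : F.obj.obj (op ⟨W, h⟩)) :
    (toInverseImage F W h h').hom y = canonical F (Y := ⟨W, h⟩) (Z := ⟨W, h'⟩) le_rfl y :=
  (congrArg _ (res_rfl ((saSaInclusion n d X S).op.lan.obj F.obj) le_rfl _)).symm

/-- Products of members of locally finite coverings of the factors. This makes the colimit defining
`preInverseImage` run over a nonempty category. -/
theorem isBisubanalytic_top [SecondCountableTopology X] [SecondCountableTopology S] :
    IsBisubanalytic X S n d ⊤ := by
  obtain ⟨α, f, hf, hft, hfl⟩ := exists_locallyFinite_subanalytic (n := n) X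
  obtain ⟨β, g, hg, hgt, hgl⟩ := exists_locallyFinite_subanalytic (n := d) S
  have := isBisubanalytic_iSup (n := n) (d := d) (fun p : α × β => rect (f p.1) (g p.2))
    (fun p => ⟨_, _, hf p.1, hg p.2, rfl⟩) (by
      intro x
      obtain ⟨t, ht, h⟩ := hfl x.1
      obtain ⟨t', ht', h'⟩ := hgl x.2
      refine ⟨t ×ˢ t', prod_mem_nhds ht ht', (h.prod h').subset ?_⟩
      rintro p ⟨y, hy, hy'⟩
      exact ⟨⟨y.1, hy.1, hy'.1⟩, ⟨y.2, hy.2, hy'.2⟩⟩)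
  convert this using 1
  symm
  refine top_le_iff.1 fun x _ => ?_
  obtain ⟨a, ha⟩ := Opens.mem_iSup.1 (hft ▸ trivial : x.1 ∈ ⨆ a, f a)
  obtain ⟨b, hb⟩ := Opens.mem_iSup.1 (hgt ▸ trivial : x.2 ∈ ⨆ b, g b)
  exact Opens.mem_iSup.2 ⟨(a, b), ha, hb⟩

/-- The objects of `X_sa × S_sa` containing `Z` include the whole space and are stable under
intersection; parallel arrows coincide. Filteredness lets elements of the colimit, and equalities
between them, be represented at one stage. -/
theorem isFiltered_costructuredArrow [SecondCountableTopology X] [SecondCountableTopology S]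
    (Z : Opens (X × S)) :
    IsFiltered (CostructuredArrow (saSaInclusion n d X S).op (op Z)) where
  nonempty := ⟨CostructuredArrow.mk (Y := op ⟨⊤, isBisubanalytic_top⟩) (homOfLE le_top).op⟩
  cocone_objs A B := by
    have hA : Z ≤ A.left.unop.1 := leOfHom A.hom.unop
    have hB : Z ≤ B.left.unop.1 := leOfHom B.hom.unop
    let M : SaSa X S n d := ⟨A.left.unop.1 ⊓ B.left.unop.1, A.left.unop.2.inf B.left.unop.2⟩
    refine ⟨CostructuredArrow.mk (Y := op M) (homOfLE (le_inf hA hB)).op,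
      CostructuredArrow.homMk (homOfLE (inf_le_left : M.1 ≤ A.left.unop.1) : M ⟶ A.left.unop).op
        (Subsingleton.elim _ _),
      CostructuredArrow.homMk (homOfLE (inf_le_right : M.1 ≤ B.left.unop.1) : M ⟶ B.left.unop).op
        (Subsingleton.elim _ _), trivial⟩
  cocone_maps A B f g := ⟨B, 𝟙 _, by ext; exact Subsingleton.elim _ _⟩

theorem exists_toPreInverseImage_eq [SecondCountableTopology X] [SecondCountableTopology S]
    (F : SaSaSheaf n d X S) {Z : SaTop X S n}
    (p : (preInverseImage F).obj (op Z)) :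
    ∃ (Y : SaSa X S n d) (h : Z.1 ≤ Y.1) (y : F.obj.obj (op Y)), toPreInverseImage F h y = p := by
  have hc := (saSaInclusion n d X S).op.isPointwiseLeftKanExtensionLeftKanExtensionUnit
    F.obj (op Z.1)
  have := isFiltered_costructuredArrow (n := n) (d := d) Z.1
  obtain ⟨j, y, hy⟩ := Concrete.isColimit_exists_rep _ hc p
  exact ⟨j.left.unop, leOfHom j.hom.unop, y, hy⟩

theorem exists_res_eq_zero_of_toPreInverseImage [SecondCountableTopology X]
    [SecondCountableTopology S] (F : SaSaSheaf n d X S) {Z : SaTop X S n} {Y : SaSa X S n d}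
    (h : Z.1 ≤ Y.1) (y : F.obj.obj (op Y)) (hy : toPreInverseImage F h y = 0) :
    ∃ (Y' : SaSa X S n d) (_ : Z.1 ≤ Y'.1) (h' : Y' ≤ Y), res F.obj h' y = 0 := by
  have hc := (saSaInclusion n d X S).op.isPointwiseLeftKanExtensionLeftKanExtensionUnit
    F.obj (op Z.1)
  have := isFiltered_costructuredArrow (n := n) (d := d) Z.1
  let j : CostructuredArrow (saSaInclusion n d X S).op (op Z.1) :=
    CostructuredArrow.mk (Y := op Y) (homOfLE h).op
  obtain ⟨k, f, g, hk⟩ := Concrete.isColimit_exists_of_rep_eq _ hc (i := j) (j := j) y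
    (0 : F.obj.obj (op Y)) (hy.trans (map_zero (toPreInverseImage F h)).symm)
  exact ⟨k.left.unop, leOfHom k.hom.unop, leOfHom f.left.unop,
    hk.trans (map_zero (res F.obj (leOfHom g.left.unop)))⟩

/-- The morphism from a presheaf to its sheafification is locally surjective, and each section of
the presheaf is represented at a stage of a filtered colimit. -/
theorem exists_sieve_canonical_eq [SecondCountableTopology X] [SecondCountableTopology S]
    (F : SaSaSheaf n d X S) {W : SaTop X S n}
    (α : (inverseImage F).obj.obj (op W)) :
    ∃ R ∈ saTopTopology n X S W, ∀ (Z : SaTop X S n) (hZ : Z ≤ W), R.arrows (homOfLE hZ) →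
      ∃ (Y : SaSa X S n d) (h : Z.1 ≤ Y.1) (y : F.obj.obj (op Y)),
        canonical F h y = res (inverseImage F).obj hZ α := by
  refine ⟨_, Presheaf.imageSieve_mem (saTopTopology n X S)
    (toSheafify (saTopTopology n X S) (preInverseImage F)) (U := op W) α, ?_⟩
  rintro Z hZ ⟨p, hp⟩
  obtain ⟨Y, h, y, rfl⟩ := exists_toPreInverseImage_eq F p
  exact ⟨Y, h, y, hp⟩

/-- The companion of `exists_sieve_canonical_eq`, from local injectivity of sheafification. The
object `Y'` on which `y` vanishes depends on the member `T`, hence the need for finite refinements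
later. -/
theorem exists_sieve_res_eq_zero [SecondCountableTopology X] [SecondCountableTopology S]
    (F : SaSaSheaf n d X S) {Z : SaTop X S n} {Y : SaSa X S n d} (h : Z.1 ≤ Y.1)
    (y : F.obj.obj (op Y)) (hy : canonical F h y = 0) :
    ∃ R ∈ saTopTopology n X S Z, ∀ (T : SaTop X S n) (hT : T ≤ Z), R.arrows (homOfLE hT) →
      ∃ (Y' : SaSa X S n d) (_ : T.1 ≤ Y'.1) (h' : Y' ≤ Y), res F.obj h' y = 0 := by
  refine ⟨_, Presheaf.equalizerSieve_mem (saTopTopology n X S)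
    (toSheafify (saTopTopology n X S) (preInverseImage F)) (X := op Z)
      (toPreInverseImage F h y) 0 (hy.trans (map_zero ((toSheafify (saTopTopology n X S)
        (preInverseImage F)).app (op Z)).hom).symm), ?_⟩
  intro T hT hR
  refine exists_res_eq_zero_of_toPreInverseImage F (le_trans (show T.1 ≤ Z.1 from hT) h) y ?_
  rw [← res_toPreInverseImage F h hT]
  exact hR.trans (map_zero (res (preInverseImage F) hT))

end Canonical

end RelSub

namespace RelSub

/-! ### Inner subsets, explicit coverings and weak quasi-compactness -/

section Inner

variable {n d : ℕ} {X : Type u} {S : Type v} [TopologicalSpace X] [TopologicalSpace S]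
  [ChartedSpace (EuclideanSpace ℝ (Fin n)) X] [ChartedSpace (EuclideanSpace ℝ (Fin d)) S]

/-- `Y` is contained in a finite union of sets `U × C ⊆ W` with `U` relatively compact subanalytic
and `C` compact. -/
def IsInner (n : ℕ) {X : Type u} {S : Type v} [TopologicalSpace X] [TopologicalSpace S]
    [ChartedSpace (EuclideanSpace ℝ (Fin n)) X] (Y W : Set (X × S)) : Prop :=
  ∃ t : Set (Opens X × Set S), t.Finite ∧
    (∀ p ∈ t, (IsSubanalytic n (p.1 : Set X) ∧ IsCompact (closure (p.1 : Set X))) ∧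
      IsCompact p.2 ∧ (p.1 : Set X) ×ˢ p.2 ⊆ W) ∧
    Y ⊆ ⋃ p ∈ t, (p.1 : Set X) ×ˢ p.2

theorem IsInner.mono {Y Y' W W' : Set (X × S)} (h : IsInner n Y W) (hY : Y' ⊆ Y) (hW : W ⊆ W') :
    IsInner n Y' W' := by
  obtain ⟨t, h1, h2, h3⟩ := h
  exact ⟨t, h1, fun p hp => ⟨(h2 p hp).1, (h2 p hp).2.1, (h2 p hp).2.2.trans hW⟩, hY.trans h3⟩

theorem isInner_prod {U : Opens X} (hU : IsSubanalytic n (U : Set X))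
    (hUc : IsCompact (closure (U : Set X))) {C V : Set S} (hC : IsCompact C) (hCV : C ⊆ V) :
    IsInner n ((U : Set X) ×ˢ C) ((U : Set X) ×ˢ V) :=
  ⟨{(U, C)}, Set.finite_singleton _, by
    rintro _ rfl; exact ⟨⟨hU, hUc⟩, hC, Set.prod_mono_right hCV⟩, by simp⟩

theorem isInner_biUnion {ι : Type*} {t : Set ι} (ht : t.Finite) {Y : ι → Set (X × S)}
    {W : Set (X × S)} (h : ∀ i ∈ t, IsInner n (Y i) W) : IsInner n (⋃ i ∈ t, Y i) W := by
  choose! T h1 h2 h3 using h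
  refine ⟨⋃ i ∈ t, T i, ht.biUnion h1, fun p hp => ?_, ?_⟩
  · obtain ⟨i, hi, hp⟩ := Set.mem_iUnion₂.1 hp
    exact h2 i hi p hp
  · refine Set.iUnion₂_subset fun i hi => (h3 i hi).trans ?_
    exact Set.biUnion_subset_biUnion_left (Set.subset_biUnion_of_mem hi)

/-- Intersect the rectangles of the two families pairwise. This is what makes overlaps of shrunk
rectangles inner in overlaps of the larger ones. -/
theorem IsInner.inter [T2Space X] [T2Space S] [IsManifold (𝓡 n) ω X] {Y W W' : Set (X × S)}
    (h : IsInner n Y W) (h' : IsInner n Y W') : IsInner n Y (W ∩ W') := by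
  obtain ⟨t, h1, h2, h3⟩ := h
  obtain ⟨t', h1', h2', h3'⟩ := h'
  refine ⟨(fun q : (Opens X × Set S) × (Opens X × Set S) => (q.1.1 ⊓ q.2.1, q.1.2 ∩ q.2.2)) ''
    (t ×ˢ t'), (h1.prod h1').image _, ?_, ?_⟩
  · rintro _ ⟨⟨p, q⟩, ⟨hp, hq⟩, rfl⟩
    obtain ⟨⟨a, b⟩, c, e⟩ := h2 p hp
    obtain ⟨⟨a', b'⟩, c', e'⟩ := h2' q hq
    exact ⟨⟨a.inter a', b.closure_of_subset (Set.inter_subset_left.trans subset_closure)⟩,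
      c.inter c', Set.subset_inter
        ((Set.prod_mono Set.inter_subset_left Set.inter_subset_left).trans e)
        ((Set.prod_mono Set.inter_subset_right Set.inter_subset_right).trans e')⟩
  · intro x hx
    obtain ⟨p, hp, hxp⟩ := Set.mem_iUnion₂.1 (h3 hx)
    obtain ⟨q, hq, hxq⟩ := Set.mem_iUnion₂.1 (h3' hx)
    exact Set.mem_iUnion₂.2 ⟨_, ⟨(p, q), ⟨hp, hq⟩, rfl⟩, ⟨hxp.1, hxq.1⟩, hxp.2, hxq.2⟩

/-- A tube lemma without compactness of `A`: `W` is a finite union of rectangles, and `N` is the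
intersection of the second factors that contain `s`. -/
theorem IsRelSubanalytic.exists_tube {W : Opens (X × S)} (hW : IsRelSubanalytic X S n W)
    {A : Set X} {s : S} (h : A ×ˢ {s} ⊆ (W : Set (X × S))) :
    ∃ N : Opens S, s ∈ N ∧ A ×ˢ (N : Set S) ⊆ (W : Set (X × S)) := by
  obtain ⟨𝒬, hf, hQ, rfl⟩ := hW
  choose! U V hU hUV using hQ
  refine ⟨⟨⋂ Q ∈ {Q ∈ 𝒬 | s ∈ V Q}, (V Q : Set S),
    (hf.subset (Set.sep_subset _ _)).isOpen_biInter fun Q _ => (V Q).isOpen⟩,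
    Set.mem_iInter₂.2 fun Q hQ => hQ.2, ?_⟩
  rintro ⟨x, s'⟩ ⟨hx, hs'⟩
  obtain ⟨Q, hQ, hxQ⟩ := Opens.mem_sSup.1 (h (show (x, s) ∈ A ×ˢ {s} from ⟨hx, rfl⟩))
  rw [hUV Q hQ] at hxQ
  refine Opens.mem_sSup.2 ⟨Q, hQ, ?_⟩
  rw [hUV Q hQ]
  exact ⟨hxQ.1, Set.mem_iInter₂.1 hs' Q ⟨hQ, hxQ.2⟩⟩

theorem exists_subanalytic_closure_subset [T2Space S] [IsManifold (𝓡 d) ω S] {N : Opens S} {s : S}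
    (hs : s ∈ N) : ∃ M : Opens S, s ∈ M ∧ (IsSubanalytic d (M : Set S) ∧
      IsCompact (closure (M : Set S))) ∧ closure (M : Set S) ⊆ N := by
  have : LocallyCompactSpace S := ChartedSpace.locallyCompactSpace (EuclideanSpace ℝ (Fin d)) S
  obtain ⟨K, hK, hKc, hKN⟩ := exists_mem_nhds_isClosed_subset (N.isOpen.mem_nhds hs)
  obtain ⟨M, ⟨h1, h2, h3, h4⟩, hMK⟩ := (hasBasis_subanalytic (n := d) s).mem_iff.1 hK
  exact ⟨⟨M, h1⟩, h2, ⟨h3, h4⟩, (closure_minimal hMK hKc).trans hKN⟩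

/-- Over an inner subset, a covering of `W` has a finite refinement by rectangles which can be
shrunk in the direction of `S`. -/
theorem exists_finite_refinement [T2Space X] [T2Space S] [IsManifold (𝓡 n) ω X]
    [IsManifold (𝓡 d) ω S] {W : SaTop X S n} {R : Sieve W} (hR : R ∈ saTopTopology n X S W)
    {Y : Set (X × S)} (hY : IsInner n Y W.1) :
    ∃ t : Set (Opens X × Opens S × Opens S), t.Finite ∧ (∀ p ∈ t,
      IsCompact (closure (p.1 : Set X)) ∧
      (IsSubanalytic d (p.2.1 : Set S) ∧ IsCompact (closure (p.2.1 : Set S))) ∧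
      (IsSubanalytic d (p.2.2 : Set S) ∧ IsCompact (closure (p.2.2 : Set S))) ∧
      closure (p.2.1 : Set S) ⊆ p.2.2 ∧
      ∃ (hU : IsSubanalytic n (p.1 : Set X)) (h : SaTop.rect p.1 hU p.2.2 ≤ W),
        R.arrows (homOfLE h)) ∧
      IsInner n Y (⋃ p ∈ t, (p.1 : Set X) ×ˢ (p.2.1 : Set S)) := by
  rw [saTopTopology_eq] at hR
  obtain ⟨𝒞, hfin, h𝒞, hsub⟩ := hY
  have key : ∀ p ∈ 𝒞, ∃ t : Set (Opens X × Opens S × Opens S), t.Finite ∧ (∀ p ∈ t,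
      IsCompact (closure (p.1 : Set X)) ∧
      (IsSubanalytic d (p.2.1 : Set S) ∧ IsCompact (closure (p.2.1 : Set S))) ∧
      (IsSubanalytic d (p.2.2 : Set S) ∧ IsCompact (closure (p.2.2 : Set S))) ∧
      closure (p.2.1 : Set S) ⊆ p.2.2 ∧
      ∃ (hU : IsSubanalytic n (p.1 : Set X)) (h : SaTop.rect p.1 hU p.2.2 ≤ W),
        R.arrows (homOfLE h)) ∧
      (p.1 : Set X) ×ˢ p.2 ⊆ ⋃ p ∈ t, (p.1 : Set X) ×ˢ (p.2.1 : Set S) := by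
    rintro ⟨U, C⟩ hp
    obtain ⟨⟨hU, hUc⟩, hC, hUC⟩ := h𝒞 _ hp
    have loc : ∀ s ∈ C, ∃ (M N : Opens S), s ∈ M ∧
        (IsSubanalytic d (M : Set S) ∧ IsCompact (closure (M : Set S))) ∧
        (IsSubanalytic d (N : Set S) ∧ IsCompact (closure (N : Set S))) ∧
        closure (M : Set S) ⊆ N ∧ ∃ 𝒰 : Set (Opens X), 𝒰.Finite ∧ U = sSup 𝒰 ∧ ∀ U' ∈ 𝒰,
        ∃ (hU' : IsSubanalytic n (U' : Set X)) (h : SaTop.rect U' hU' N ≤ W),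
          R.arrows (homOfLE h) := by
      intro s hs
      obtain ⟨V, hsV, hV⟩ := W.2.exists_tube (A := (U : Set X)) (s := s)
        ((Set.prod_mono_right (Set.singleton_subset_iff.2 hs)).trans hUC)
      -- The covering gives `N₀`; two successive shrinkings produce the relatively compact pair `M
      -- ⊂⊂ N ⊂⊂ N₀`.
      obtain ⟨N₀, hsN₀, -, 𝒰, h1, h2, h3⟩ := hR U hU hUc V hV s hsV
      obtain ⟨N, hsN, hN, hNN⟩ := exists_subanalytic_closure_subset (d := d) hsN₀
      obtain ⟨M, hsM, hM, hMN⟩ := exists_subanalytic_closure_subset (d := d) hsN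
      refine ⟨M, N, hsM, hM, hN, hMN, 𝒰, h1, h2, fun U' hU' => ?_⟩
      obtain ⟨a, b, c⟩ := h3 U' hU'
      have hle : SaTop.rect U' a N ≤ SaTop.rect U' a N₀ :=
        Set.prod_mono_right (subset_closure.trans hNN)
      exact ⟨a, hle.trans b, R.downward_closed c (homOfLE hle)⟩
    choose! M N hsM hM hN hMN 𝒰 h1 h2 h3 using loc
    obtain ⟨b, hb, hbC⟩ := hC.elim_nhds_subcover (fun s => (M s : Set S))
      fun s hs => (M s).isOpen.mem_nhds (hsM s hs)
    refine ⟨⋃ s ∈ (b : Set S), (fun U' => (U', M s, N s)) '' 𝒰 s,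
      b.finite_toSet.biUnion fun s hs => (h1 s (hb s hs)).image _, ?_, ?_⟩
    · intro q hq
      obtain ⟨s, hs, U', hU', rfl⟩ := Set.mem_iUnion₂.1 hq
      have hs' := hb s hs
      refine ⟨hUc.closure_of_subset ?_, hM s hs', hN s hs', hMN s hs', h3 s hs' U' hU'⟩
      exact Set.Subset.trans (show (U' : Set X) ⊆ U from (le_sSup hU').trans (h2 s hs').symm.le)
        subset_closure
    · rintro ⟨x, s⟩ ⟨hx, hs⟩
      obtain ⟨s', hs', hss⟩ := Set.mem_iUnion₂.1 (hbC hs)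
      have hx' : x ∈ U := hx
      rw [h2 s' (hb s' hs')] at hx'
      obtain ⟨U', hU', hxU'⟩ := Opens.mem_sSup.1 hx'
      exact Set.mem_iUnion₂.2 ⟨(U', M s', N s'), Set.mem_iUnion₂.2 ⟨s', hs', U', hU', rfl⟩,
        hxU', hss⟩
  choose! T hT1 hT2 hT3 using key
  -- The products `U × C` witnessing that `Y` is inner in `W` lie in the new union, so the same `𝒞`
  -- witnesses the stronger conclusion.
  refine ⟨⋃ p ∈ 𝒞, T p, hfin.biUnion hT1, fun q hq => ?_, 𝒞, hfin, fun p hp => ?_, hsub⟩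
  · obtain ⟨p, hp, hq⟩ := Set.mem_iUnion₂.1 hq
    exact hT2 p hp q hq
  · exact ⟨(h𝒞 p hp).1, (h𝒞 p hp).2.1, (hT3 p hp).trans
      (Set.biUnion_subset_biUnion_left (Set.subset_biUnion_of_mem hp))⟩

theorem isRelSubanalytic_biSup {ι : Type*} {t : Set ι} (ht : t.Finite) {U : ι → Opens X}
    {V : ι → Opens S} (hU : ∀ i ∈ t, IsSubanalytic n (U i : Set X)) :
    IsRelSubanalytic X S n (⨆ i ∈ t, rect (U i) (V i)) :=
  ⟨(fun i => rect (U i) (V i)) '' t, ht.image _, by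
    rintro _ ⟨i, hi, rfl⟩; exact ⟨_, _, hU i hi, rfl⟩, sSup_image.symm⟩

theorem isBisubanalytic_biSup {ι : Type*} {t : Set ι} (ht : t.Finite) {Q : ι → Opens (X × S)}
    (hQ : ∀ i ∈ t, Q i ∈ basicRects X S n d) : IsBisubanalytic X S n d (⨆ i ∈ t, Q i) := by
  have := ht.to_subtype
  rw [iSup_subtype']
  exact isBisubanalytic_iSup _ (fun i => hQ i i.2) (locallyFinite_of_finite _)

theorem IsRelSubanalytic.inf [T2Space X] [IsManifold (𝓡 n) ω X] {W W' : Opens (X × S)}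
    (h : IsRelSubanalytic X S n W) (h' : IsRelSubanalytic X S n W') :
    IsRelSubanalytic X S n (W ⊓ W') := by
  obtain ⟨𝒬, hf, hQ, rfl⟩ := h
  obtain ⟨𝒬', hf', hQ', rfl⟩ := h'
  refine ⟨(fun p : Opens (X × S) × Opens (X × S) => p.1 ⊓ p.2) '' (𝒬 ×ˢ 𝒬'),
    (hf.prod hf').image _, ?_, ?_⟩
  · rintro _ ⟨⟨Q, Q'⟩, ⟨h1, h2⟩, rfl⟩
    obtain ⟨U, V, hU, rfl⟩ := hQ Q h1
    obtain ⟨U', V', hU', rfl⟩ := hQ' Q' h2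
    exact ⟨U ⊓ U', V ⊓ V', hU.inter hU', rect_inf _ _ _ _⟩
  · rw [sSup_inf_sSup, sSup_image]

/-- A criterion for families that need shrinking only in the direction of `S`: `U` is kept whole.
The point `x` records that `U` is nonempty, so that inclusions of rectangles give inclusions of
their factors. -/
theorem ofObjects_mem_saTopTopology [T2Space X] [IsManifold (𝓡 n) ω X] {W : SaTop X S n}
    {ι : Type*} {Z : ι → SaTop X S n}
    (h : ∀ (U : Opens X), IsSubanalytic n (U : Set X) → IsCompact (closure (U : Set X)) →
      ∀ V : Opens S, rect U V ≤ W.1 → ∀ s ∈ V, ∀ x ∈ U, ∃ N : Opens S, s ∈ N ∧ N ≤ V ∧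
        ∃ i, rect U N ≤ (Z i).1) :
    Sieve.ofObjects Z W ∈ saTopTopology n X S W := by
  rw [saTopTopology_eq]
  intro U hU hUc V hUV s hs
  rcases (U : Set X).eq_empty_or_nonempty with he | ⟨x, hx⟩
  · exact ⟨V, hs, le_rfl, ∅, Set.finite_empty, by ext x; simp [he], by simp⟩
  obtain ⟨N, hsN, hNV, i, hi⟩ := h U hU hUc V hUV s hs x hx
  refine ⟨N, hsN, hNV, {U}, Set.finite_singleton _, by simp, ?_⟩
  rintro _ rfl
  exact ⟨hU, (Set.prod_mono_right hNV).trans hUV, i, ⟨homOfLE hi⟩⟩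

/-- Decompose all `Z i` into finitely many rectangles `A × B` and keep those with `s ∈ B`. Their
sets `A` cover `U`, as seen on the slice at `s`, and the finite intersection of the `B` is a
neighbourhood of `s`. -/
theorem ofObjects_mem_saTopTopology_of_finite [T2Space X] [IsManifold (𝓡 n) ω X]
    {W : SaTop X S n} {ι : Type*} [Finite ι] {Z : ι → SaTop X S n}
    (h : (W.1 : Set (X × S)) ⊆ ⋃ i, ((Z i).1 : Set (X × S))) :
    Sieve.ofObjects Z W ∈ saTopTopology n X S W := by
  rw [saTopTopology_eq]
  intro U hU hUc V hUV s hs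
  choose 𝒬 hf hQ hZ using fun i => (Z i).2
  choose! A B hA hAB using hQ
  let T : Set (ι × Opens (X × S)) := {p | p.2 ∈ 𝒬 p.1 ∧ s ∈ B p.1 p.2}
  have hT : T.Finite := by
    refine (Set.finite_iUnion fun i => (hf i).image (Prod.mk i)).subset ?_
    rintro ⟨i, Q⟩ hp
    exact Set.mem_iUnion.2 ⟨i, Q, hp.1, rfl⟩
  refine ⟨⟨(V : Set S) ∩ ⋂ p ∈ T, (B p.1 p.2 : Set S), V.isOpen.inter
    (hT.isOpen_biInter fun p _ => (B p.1 p.2).isOpen)⟩, ⟨hs, Set.mem_iInter₂.2 fun p hp => hp.2⟩,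
    fun y hy => hy.1, (fun p => U ⊓ A p.1 p.2) '' T, hT.image _, ?_, ?_⟩
  · apply le_antisymm
    · intro x hx
      obtain ⟨i, hi⟩ := Set.mem_iUnion.1 (h (hUV (show (x, s) ∈ rect U V from ⟨hx, hs⟩)))
      rw [hZ i] at hi
      obtain ⟨Q, hQ, hxQ⟩ := Opens.mem_sSup.1 hi
      rw [hAB i Q hQ] at hxQ
      exact Opens.mem_sSup.2 ⟨_, ⟨(i, Q), ⟨hQ, hxQ.2⟩, rfl⟩, hx, hxQ.1⟩
    · refine sSup_le ?_
      rintro _ ⟨p, _, rfl⟩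
      exact inf_le_left
  · rintro _ ⟨⟨i, Q⟩, hp, rfl⟩
    refine ⟨hU.inter (hA i Q hp.1), fun y hy => hUV ⟨hy.1.1, hy.2.1⟩, i, ⟨homOfLE ?_⟩⟩
    intro y hy
    change y ∈ (Z i).1
    rw [hZ i]
    refine Opens.mem_sSup.2 ⟨Q, hp.1, ?_⟩
    rw [hAB i Q hp.1]
    exact ⟨hy.1.2, Set.mem_iInter₂.1 hy.2.2 _ hp⟩

/-- Coverings are set-theoretically surjective: the explicit description applies after cutting a
rectangle through `x` down to a relatively compact one. -/
theorem exists_mem_of_mem_saTopTopology [T2Space X] [IsManifold (𝓡 n) ω X] {W : SaTop X S n}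
    {R : Sieve W} (hR : R ∈ saTopTopology n X S W) {x : X × S} (hx : x ∈ W.1) :
    ∃ (Z : SaTop X S n) (h : Z ≤ W), R.arrows (homOfLE h) ∧ x ∈ Z.1 := by
  rw [saTopTopology_eq] at hR
  obtain ⟨𝒬, hf, hQ, hW⟩ := W.2
  rw [hW] at hx
  obtain ⟨Q, hQ𝒬, hxQ⟩ := Opens.mem_sSup.1 hx
  obtain ⟨A, B, hA, rfl⟩ := hQ Q hQ𝒬
  obtain ⟨U, h1, h2, h3, h4⟩ := (hasBasis_subanalytic (n := n) x.1).ex_mem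
  obtain ⟨N, hN, -, 𝒰, -, he, h𝒰⟩ := hR (A ⊓ ⟨U, h1⟩) (hA.inter h3)
    (h4.closure_of_subset (Set.inter_subset_right.trans subset_closure)) B
    (le_trans (show rect (A ⊓ ⟨U, h1⟩) B ≤ rect A B from Set.prod_mono_left Set.inter_subset_left)
      ((le_sSup hQ𝒬).trans hW.ge)) x.2 hxQ.2
  have hx1 : x.1 ∈ A ⊓ ⟨U, h1⟩ := ⟨hxQ.1, h2⟩
  rw [he] at hx1
  obtain ⟨U', hU', hxU'⟩ := Opens.mem_sSup.1 hx1
  obtain ⟨a, b, c⟩ := h𝒰 U' hU'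
  exact ⟨_, b, c, hxU', hN⟩

variable (d) in
-- The objects contained in some `U × C ⊆ W` cover `W`; a finite refinement of this particular
-- covering exhibits `W'` as inner. Conversely, intersect with `W'` the finite refinement which any
-- covering has over an inner subset.
theorem isWeaklyQuasiCompact_iff [T2Space X] [T2Space S] [IsManifold (𝓡 n) ω X]
    [IsManifold (𝓡 d) ω S] {W' W : SaTop X S n} (h : W' ≤ W) :
    IsWeaklyQuasiCompact (saTopTopology n X S) h ↔ IsInner n (W'.1 : Set (X × S)) W.1 := by
  constructor
  · intro hw
    let ι := {Z : SaTop X S n // ∃ (U : Opens X) (C : Set S), IsSubanalytic n (U : Set X) ∧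
      IsCompact (closure (U : Set X)) ∧ IsCompact C ∧ (Z.1 : Set (X × S)) ⊆ (U : Set X) ×ˢ C ∧
      (U : Set X) ×ˢ C ⊆ W.1}
    have hcov : Sieve.ofObjects (fun Z : ι => Z.1) W ∈ saTopTopology n X S W := by
      refine ofObjects_mem_saTopTopology fun U hU hUc V hUV s hs _ _ => ?_
      obtain ⟨N, hsN, hN, hNV⟩ := exists_subanalytic_closure_subset (d := d) hs
      exact ⟨N, hsN, subset_closure.trans hNV, ⟨SaTop.rect U hU N, U, _, hU, hUc, hN.2,
        Set.prod_mono_right subset_closure, (Set.prod_mono_right hNV).trans hUV⟩, le_rfl⟩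
    obtain ⟨t, ht, htR, hc⟩ := hw _ hcov
    refine (isInner_biUnion (Y := fun Z : SaTop X S n => (Z.1 : Set (X × S))) ht
      fun Z hZ => ?_).mono (fun x hx => ?_) le_rfl
    · obtain ⟨-, ⟨⟨Z', U, C, h1, h2, h3, h4, h5⟩, ⟨f⟩⟩⟩ := htR Z hZ
      refine IsInner.mono (isInner_prod h1 h2 h3 subset_rfl) ?_ h5
      exact (show (Z.1 : Set (X × S)) ⊆ Z'.1 from leOfHom f).trans h4
    · obtain ⟨Z, -, ⟨⟨Z', hZ'⟩, ⟨f⟩⟩, hxZ⟩ := exists_mem_of_mem_saTopTopology hc hx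
      exact Set.mem_iUnion₂.2 ⟨Z', hZ', leOfHom f hxZ⟩
  · intro hI R hR
    obtain ⟨t, ht, h1, h2⟩ := exists_finite_refinement (d := d) hR hI
    let g : t → SaTop X S n := fun p =>
      ⟨rect p.1.1 p.1.2.2 ⊓ W'.1, (SaTop.rect p.1.1 (h1 p p.2).2.2.2.2.choose p.1.2.2).2.inf W'.2⟩
    have := ht.to_subtype
    refine ⟨Set.range g, Set.finite_range g, ?_, ofObjects_mem_saTopTopology_of_finite ?_⟩
    · rintro _ ⟨p, rfl⟩
      obtain ⟨hU, hle, hRa⟩ := (h1 p p.2).2.2.2.2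
      refine ⟨inf_le_right (a := rect p.1.1 p.1.2.2), ?_⟩
      exact R.downward_closed hRa (homOfLE (inf_le_left (b := W'.1)) : g p ⟶ _)
    · intro x hx
      obtain ⟨T, -, hT, hTs⟩ := h2
      obtain ⟨q, hq, hxq⟩ := Set.mem_iUnion₂.1 (hTs hx)
      obtain ⟨p, hp, hxp⟩ := Set.mem_iUnion₂.1 ((hT q hq).2.2 hxq)
      exact Set.mem_iUnion.2 ⟨⟨g ⟨p, hp⟩, ⟨p, hp⟩, rfl⟩,
        ⟨hxp.1, (h1 p hp).2.2.2.1 (subset_closure hxp.2)⟩, hx⟩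

theorem ofObjects_mem_saSaTopology_of_finite [T2Space X] [T2Space S] [IsManifold (𝓡 n) ω X]
    [IsManifold (𝓡 d) ω S] {W : SaSa X S n d} {ι : Type*} [Finite ι] {Z : ι → SaSa X S n d}
    (hZ : ∀ i, Z i ≤ W) (h : (W.1 : Set (X × S)) ⊆ ⋃ i, ((Z i).1 : Set (X × S))) :
    Sieve.ofObjects Z W ∈ saSaTopology n d X S W := by
  intro Q _ hQW
  refine ⟨Set.range Z, Set.finite_range Z, ?_, ?_⟩
  · rintro _ ⟨i, rfl⟩
    exact ⟨hZ i, i, ⟨𝟙 _⟩⟩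
  · rw [Set.biUnion_range]
    exact (show (Q : Set (X × S)) ⊆ W.1 from hQW).trans h

end Inner

end RelSub

/-! ### Comparing sections of `F` with sections of the inverse image -/

namespace RelSub

/-- Gluing morphisms out of `E` directly, so that the map from the projective limit is linear by
construction. -/
theorem exists_glue_hom {C : Type w} [Preorder C] {J : GrothendieckTopology C}
    {G : Cᵒᵖ ⥤ ModuleCat.{w} ℂ} (hG : Presheaf.IsSheaf J G) {W : C} {ι : Type*} {Z : ι → C}
    (hZ : ∀ i, Z i ≤ W) (hJ : Sieve.ofObjects Z W ∈ J W) {E : ModuleCat.{w} ℂ}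
    (x : ∀ i, E ⟶ G.obj (op (Z i)))
    (h : ∀ i j T (hi : T ≤ Z i) (hj : T ≤ Z j) (y : E),
      res G hi ((x i).hom y) = res G hj ((x j).hom y)) :
    ∃ y : E ⟶ G.obj (op W), ∀ i, y ≫ G.map (homOfLE (hZ i)).op = x i := by
  have h' : ∀ i j T (hi : T ⟶ Z i) (hj : T ⟶ Z j), x i ≫ G.map hi.op = x j ≫ G.map hj.op := by
    intro i j T hi hj
    ext y
    exact h i j T (leOfHom hi) (leOfHom hj) y
  let fam : Presieve.FamilyOfElements (G ⋙ coyoneda.obj (op E)) (Sieve.ofObjects Z W).arrows :=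
    fun T f hf => x hf.choose ≫ G.map hf.choose_spec.some.op
  have hfam : fam.Compatible := by
    intro T₁ T₂ T g₁ g₂ f₁ f₂ h₁ h₂ e
    change (x _ ≫ G.map _) ≫ G.map g₁.op = (x _ ≫ G.map _) ≫ G.map g₂.op
    rw [Category.assoc, Category.assoc, ← G.map_comp, ← G.map_comp]
    exact h' _ _ _ (g₁ ≫ _) (g₂ ≫ _)
  obtain ⟨y, hy, _⟩ := hG E _ hJ fam hfam
  refine ⟨y, fun i => (hy (homOfLE (hZ i)) ⟨i, ⟨𝟙 _⟩⟩).trans ?_⟩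
  refine (h' _ i _ _ (𝟙 _)).trans ?_
  rw [op_id, G.map_id, Category.comp_id]

theorem IsInner.subset {n : ℕ} {X : Type u} {S : Type v} [TopologicalSpace X] [TopologicalSpace S]
    [ChartedSpace (EuclideanSpace ℝ (Fin n)) X] {Y W : Set (X × S)} (h : IsInner n Y W) :
    Y ⊆ W := by
  obtain ⟨t, -, h2, h3⟩ := h
  exact h3.trans (Set.iUnion₂_subset fun p hp => (h2 p hp).2.2)

noncomputable section Main

variable {n d : ℕ} {X : Type u} {S : Type v} [TopologicalSpace X] [TopologicalSpace S]
  [ChartedSpace (EuclideanSpace ℝ (Fin n)) X] [ChartedSpace (EuclideanSpace ℝ (Fin d)) S]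
  [T2Space X] [T2Space S] [IsManifold (𝓡 n) ω X] [IsManifold (𝓡 d) ω S]

/-- Coverings of `X_sa × S_sa` are tested on elements of `𝒯`, so only relatively compact `U' ⊆ U`
matter, even when `U` is not relatively compact. -/
theorem rect_mem_saSaTopology [SecondCountableTopology X] {U : Opens X}
    (hU : IsSubanalytic n (U : Set X)) {V : Opens S} (hV : IsSubanalytic d (V : Set S))
    (hVc : IsCompact (closure (V : Set S))) {ι : Type*} {Z : ι → SaSa X S n d}
    (hZ : ∀ i, Z i ≤ SaSa.rect U hU V hV hVc)
    (h : ∀ U' : Opens X, IsSubanalytic n (U' : Set X) → IsCompact (closure (U' : Set X)) →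
      U' ≤ U → ∃ t : Set ι, t.Finite ∧
        (U' : Set X) ×ˢ (V : Set S) ⊆ ⋃ i ∈ t, ((Z i).1 : Set (X × S))) :
    Sieve.ofObjects Z (SaSa.rect U hU V hV hVc) ∈ saSaTopology n d X S _ := by
  intro Q hQ hQW
  -- An empty product does not force its factors into `U` and `V`.
  rcases (Q : Set (X × S)).eq_empty_or_nonempty with he | ⟨⟨x, s⟩, hxs⟩
  · exact ⟨∅, Set.finite_empty, by simp, by simp [he]⟩
  obtain ⟨U', V', hU', hV', rfl⟩ := hQ
  have hle : (U' : Set X) ⊆ U := fun y hy =>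
    (hQW (show (y, s) ∈ rect U' V' from ⟨hy, hxs.2⟩)).1
  have hle' : (V' : Set S) ⊆ V := fun y hy =>
    (hQW (show (x, y) ∈ rect U' V' from ⟨hxs.1, hy⟩)).2
  obtain ⟨t, ht, htc⟩ := h U' hU'.1 hU'.2 hle
  refine ⟨Z '' t, ht.image Z, ?_, ?_⟩
  · rintro _ ⟨i, _, rfl⟩
    exact ⟨hZ i, i, ⟨𝟙 _⟩⟩
  · rw [Set.biUnion_image]
    exact (Set.prod_mono_right hle').trans htc

/-- Injectivity near inner objects: `y` vanishes on finitely many objects `T p`, which together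
cover `Y'`, and `F` is separated for finite coverings. -/
theorem res_eq_zero_of_isInner [SecondCountableTopology X] [SecondCountableTopology S]
    (F : SaSaSheaf n d X S) {Y : SaSa X S n d} {Z : SaTop X S n} (h : Z.1 ≤ Y.1)
    (y : F.obj.obj (op Y)) (hy : canonical F h y = 0) {Y' : SaSa X S n d} (h' : Y' ≤ Y)
    (hI : IsInner n (Y'.1 : Set (X × S)) Z.1) : res F.obj h' y = 0 := by
  obtain ⟨R, hR, hRy⟩ := exists_sieve_res_eq_zero F h y hy
  obtain ⟨t, ht, h1, h2⟩ := exists_finite_refinement (d := d) hR hI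
  have key : ∀ p : t, ∃ (T : SaSa X S n d) (_ : rect p.1.1 p.1.2.2 ≤ T.1) (hT : T ≤ Y),
      res F.obj hT y = 0 := by
    intro p
    obtain ⟨hU, hle, hRa⟩ := (h1 p p.2).2.2.2.2
    exact hRy _ hle hRa
  choose T hpT hT hTy using key
  have := ht.to_subtype
  let Z' : t → SaSa X S n d := fun p => ⟨(T p).1 ⊓ Y'.1, (T p).2.inf Y'.2⟩
  have hZ' : ∀ p, Z' p ≤ Y' := fun p => inf_le_right (a := (T p).1)
  refine eq_of_res_eq_of_cover F.property (Z := Z') hZ'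
    (ofObjects_mem_saSaTopology_of_finite hZ' fun x hx => ?_) fun p => ?_
  · obtain ⟨p, hp, hxp⟩ := Set.mem_iUnion₂.1 (h2.subset hx)
    exact Set.mem_iUnion.2 ⟨⟨p, hp⟩, hpT ⟨p, hp⟩
      ⟨hxp.1, (h1 p hp).2.2.2.1 (subset_closure hxp.2)⟩, hx⟩
  · rw [res_res, map_zero, ← res_res F.obj (show Z' p ≤ T p from inf_le_left (b := Y'.1)) (hT p),
      hTy, map_zero]

theorem res_eq_res_of_isInner [SecondCountableTopology X] [SecondCountableTopology S]
    (F : SaSaSheaf n d X S) {Y₁ Y₂ : SaSa X S n d} {Z : SaTop X S n} (h₁ : Z.1 ≤ Y₁.1)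
    (h₂ : Z.1 ≤ Y₂.1) {y₁ : F.obj.obj (op Y₁)} {y₂ : F.obj.obj (op Y₂)}
    (hy : canonical F h₁ y₁ = canonical F h₂ y₂) {Y' : SaSa X S n d} (h₁' : Y' ≤ Y₁)
    (h₂' : Y' ≤ Y₂) (hI : IsInner n (Y'.1 : Set (X × S)) Z.1) :
    res F.obj h₁' y₁ = res F.obj h₂' y₂ := by
  let M : SaSa X S n d := ⟨Y₁.1 ⊓ Y₂.1, Y₁.2.inf Y₂.2⟩
  have hM₁ : M ≤ Y₁ := inf_le_left (b := Y₂.1)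
  have hM₂ : M ≤ Y₂ := inf_le_right (a := Y₁.1)
  have hM : Y' ≤ M := le_inf (show Y'.1 ≤ Y₁.1 from h₁') h₂'
  have := res_eq_zero_of_isInner F (Y := M) (le_inf h₁ h₂) (res F.obj hM₁ y₁ - res F.obj hM₂ y₂)
    (by rw [map_sub, canonical_res, canonical_res, hy, sub_self]) hM hI
  rwa [map_sub, res_res, res_res, sub_eq_zero] at this

/-- Surjectivity near inner subsets: local representatives of `α` on the `U_p × N_p` are restricted
to the `U_p × M_p` and glued over `M`, the finite union of the latter. -/
theorem exists_canonical_eq_of_isInner [SecondCountableTopology X] [SecondCountableTopology S]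
    (F : SaSaSheaf n d X S) {W : SaTop X S n} (α : (inverseImage F).obj.obj (op W))
    {Y : Set (X × S)} (hY : IsInner n Y W.1) :
    ∃ (M : SaSa X S n d) (hM : IsRelSubanalytic X S n M.1) (hMW : M.1 ≤ W.1)
      (y : F.obj.obj (op M)), IsInner n Y M.1 ∧
      canonical F (Z := ⟨M.1, hM⟩) le_rfl y =
        res (inverseImage F).obj (show (⟨M.1, hM⟩ : SaTop X S n) ≤ W from hMW) α := by
  obtain ⟨R, hR, hRy⟩ := exists_sieve_canonical_eq F α
  obtain ⟨t, ht, h1, h2⟩ := exists_finite_refinement (d := d) hR hY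
  have hU : ∀ p ∈ t, IsSubanalytic n (p.1 : Set X) := fun p hp => (h1 p hp).2.2.2.2.choose
  have hQ : ∀ p ∈ t, rect p.1 p.2.1 ∈ basicRects X S n d := fun p hp =>
    ⟨p.1, p.2.1, ⟨hU p hp, (h1 p hp).1⟩, (h1 p hp).2.1, rfl⟩
  have hQN : ∀ p ∈ t, rect p.1 p.2.1 ≤ rect p.1 p.2.2 := fun p hp =>
    Set.prod_mono_right (subset_closure.trans (h1 p hp).2.2.2.1)
  let M : SaSa X S n d := ⟨⨆ p ∈ t, rect p.1 p.2.1, isBisubanalytic_biSup ht hQ⟩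
  have hM : IsRelSubanalytic X S n M.1 := isRelSubanalytic_biSup ht hU
  have hMs : (M.1 : Set (X × S)) = ⋃ p ∈ t, (p.1 : Set X) ×ˢ (p.2.1 : Set S) := by
    simp only [M, Opens.coe_iSup]
    rfl
  have key : ∀ p : t, ∃ (T : SaSa X S n d) (hT : rect p.1.1 p.1.2.2 ≤ T.1)
      (y : F.obj.obj (op T)) (hle : SaTop.rect p.1.1 (hU p p.2) p.1.2.2 ≤ W),
      canonical F (Z := SaTop.rect p.1.1 (hU p p.2) p.1.2.2) hT y =
        res (inverseImage F).obj hle α := by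
    intro p
    obtain ⟨_, hle, hRa⟩ := (h1 p p.2).2.2.2.2
    obtain ⟨T, hT, y, hy⟩ := hRy _ hle hRa
    exact ⟨T, hT, y, hle, hy⟩
  choose T hT y hle hy using key
  have := ht.to_subtype
  let Q : t → SaSa X S n d := fun p => ⟨rect p.1.1 p.1.2.1, isBisubanalytic_of_mem (hQ p p.2)⟩
  let Q' : t → SaTop X S n := fun p => SaTop.rect p.1.1 (hU p p.2) p.1.2.1
  have hQT : ∀ p, Q p ≤ T p := fun p => (hQN p p.2).trans (hT p)
  have hQM : ∀ p, Q p ≤ M := fun p => le_biSup (fun p : Opens X × Opens S × Opens S =>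
    rect p.1 p.2.1) p.2
  have hcov : (M.1 : Set (X × S)) ⊆ ⋃ p, ((Q p).1 : Set (X × S)) := by
    rw [hMs]
    exact (Set.biUnion_eq_iUnion _ _).subset
  have hMW : M.1 ≤ W.1 := iSup₂_le fun p hp => (hQN p hp).trans (hle ⟨p, hp⟩)
  have hQI : ∀ p : t, IsInner n ((Q p).1 : Set (X × S)) (rect p.1.1 p.1.2.2) := fun p =>
    (isInner_prod (hU p p.2) (h1 p p.2).1 (h1 p p.2).2.1.2 (h1 p p.2).2.2.2.1).mono
      (Set.prod_mono_right subset_closure) subset_rfl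
  obtain ⟨z, hz⟩ := exists_glue F.property hQM (ofObjects_mem_saSaTopology_of_finite hQM hcov)
    (fun p => res F.obj (hQT p) (y p)) (by
      intro p q Y' hp hq
      rw [res_res, res_res]
      -- On the overlap `N` of the larger rectangles both representatives have image `α`; the
      -- overlap of the shrunk ones is inner in `N`, so they agree there.
      let N : SaTop X S n := ⟨rect p.1.1 p.1.2.2 ⊓ rect q.1.1 q.1.2.2,
        (SaTop.rect p.1.1 (hU p p.2) p.1.2.2).2.inf (SaTop.rect q.1.1 (hU q q.2) q.1.2.2).2⟩
      have hNp : N ≤ SaTop.rect p.1.1 (hU p p.2) p.1.2.2 :=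
        inf_le_left (b := rect q.1.1 q.1.2.2)
      have hNq : N ≤ SaTop.rect q.1.1 (hU q q.2) q.1.2.2 :=
        inf_le_right (a := rect p.1.1 p.1.2.2)
      refine res_eq_res_of_isInner F (Z := N) (le_trans (show N.1 ≤ _ from hNp) (hT p))
        (le_trans (show N.1 ≤ _ from hNq) (hT q)) ?_ _ _ ?_
      · rw [← res_canonical F (hT p) hNp, ← res_canonical F (hT q) hNq, hy, hy, res_res, res_res]
      · exact ((hQI p).mono hp subset_rfl).inter ((hQI q).mono hq subset_rfl))
  refine ⟨M, hM, hMW, z, hMs ▸ h2, ?_⟩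
  have hQ'M : ∀ p, Q' p ≤ ⟨M.1, hM⟩ := hQM
  refine eq_of_res_eq_of_cover (inverseImage F).property hQ'M
    (ofObjects_mem_saTopTopology_of_finite hcov) fun p => ?_
  have h3 : Q' p ≤ SaTop.rect p.1.1 (hU p p.2) p.1.2.2 := hQN p p.2
  have h4 : (Q' p).1 ≤ (Q p).1 := le_refl (rect p.1.1 p.1.2.1)
  rw [res_canonical, res_res, ← canonical_res F (Y' := Q p) (Z := Q' p) h4 (hQM p), hz,
    canonical_res, ← res_canonical F (hT p) h3, hy, res_res]

/-- A section of the inverse image over `W` comes from a compatible family of sections over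
the inner objects. -/
theorem exists_innerSections [SecondCountableTopology X] [SecondCountableTopology S]
    (F : SaSaSheaf n d X S) {W : SaTop X S n} (α : (inverseImage F).obj.obj (op W)) :
    ∃ x : ∀ Y : {Y : SaSa X S n d // IsInner n (Y.1 : Set (X × S)) W.1}, F.obj.obj (op Y.1),
      (∀ Y Y' (h : Y.1 ≤ Y'.1), res F.obj h (x Y') = x Y) ∧
      ∀ Y (Z : SaTop X S n) (h : Z.1 ≤ Y.1.1), canonical F h (x Y) =
        res (inverseImage F).obj (show Z ≤ W from le_trans (b := Y.1.1) h Y.2.subset) α := by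
  choose M hM hMW y hI hy using
    fun Y : {Y : SaSa X S n d // IsInner n (Y.1 : Set (X × S)) W.1} =>
      exists_canonical_eq_of_isInner F α Y.2
  have hYM : ∀ Y, Y.1 ≤ M Y := fun Y => (hI Y).subset
  have hc : ∀ Y (Z : SaTop X S n) (h : Z.1 ≤ (M Y).1), canonical F h (y Y) =
      res (inverseImage F).obj (show Z ≤ W from le_trans (b := (M Y).1) h (hMW Y)) α := by
    intro Y Z h
    rw [← res_canonical F (Z := ⟨(M Y).1, hM Y⟩) le_rfl (show Z ≤ ⟨(M Y).1, hM Y⟩ from h), hy,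
      res_res]
  refine ⟨fun Y => res F.obj (hYM Y) (y Y), fun Y Y' h => ?_, fun Y Z h => ?_⟩
  · rw [res_res]
    -- Both chosen sections represent `α` on `M Y' ∩ M Y`, in which `Y` is inner.
    refine res_eq_res_of_isInner F (Z := ⟨(M Y').1 ⊓ (M Y).1, (hM Y').inf (hM Y)⟩)
      inf_le_left inf_le_right ?_ _ _ ?_
    · rw [hc, hc]
    · exact ((hI Y').mono h subset_rfl).inter (hI Y)
  · rw [canonical_res, hc]

/-- The formal part of both isomorphisms. The sections of `F` on a downward directed system glue
over a covering of `W` to a map out of the limit; `hinj` and `hsurj` make it bijective, and a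
bijective linear map is an isomorphism. -/
theorem exists_limit_iso [SecondCountableTopology X] [SecondCountableTopology S]
    (F : SaSaSheaf n d X S) (W : SaTop X S n) {ι : Type*} [Preorder ι] {f : ι → SaSa X S n d}
    (hfm : Monotone f) (hf : ∀ i, IsRelSubanalytic X S n (f i).1) (hle : ∀ i, (f i).1 ≤ W.1)
    (hinf : ∀ i j, ∃ k, k ≤ i ∧ k ≤ j ∧ (f i).1 ⊓ (f j).1 ≤ (f k).1)
    (hcov : Sieve.ofObjects (fun i => (⟨(f i).1, hf i⟩ : SaTop X S n)) W ∈
      saTopTopology n X S W)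
    (hinj : ∀ x : ∀ i, F.obj.obj (op (f i)),
      (∀ i j (h : i ≤ j), res F.obj (hfm h) (x j) = x i) →
      (∀ i, canonical F (Z := ⟨(f i).1, hf i⟩) le_rfl (x i) = 0) → ∀ i, x i = 0)
    (hsurj : ∀ α : (inverseImage F).obj.obj (op W), ∃ x : ∀ i, F.obj.obj (op (f i)),
      (∀ i j (h : i ≤ j), res F.obj (hfm h) (x j) = x i) ∧
      ∀ i, canonical F (Z := ⟨(f i).1, hf i⟩) le_rfl (x i) =
        res (inverseImage F).obj (show (⟨(f i).1, hf i⟩ : SaTop X S n) ≤ W from hle i) α)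
    [HasLimit (hfm.functor.op ⋙ F.obj)] :
    ∃ e : limit (hfm.functor.op ⋙ F.obj) ≅ (inverseImage F).obj.obj (op W),
      ∀ i, e.hom ≫ (inverseImage F).obj.map
          (homOfLE (show (⟨(f i).1, hf i⟩ : SaTop X S n) ≤ W from hle i)).op =
        limit.π (hfm.functor.op ⋙ F.obj) (op i) ≫ toInverseImage F (f i).1 (f i).2 (hf i) := by
  let π : ∀ i, (limit (hfm.functor.op ⋙ F.obj) : ModuleCat.{max u v} ℂ) →ₗ[ℂ]
      F.obj.obj (op (f i)) := fun i => (limit.π (hfm.functor.op ⋙ F.obj) (op i)).hom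
  have hπ : ∀ i j (h : i ≤ j) x, res F.obj (hfm h) (π j x) = π i x := fun i j h x =>
    congr($(limit.w (hfm.functor.op ⋙ F.obj) (homOfLE h).op).hom x)
  obtain ⟨e, he⟩ := exists_glue_hom (inverseImage F).property
    (Z := fun i => (⟨(f i).1, hf i⟩ : SaTop X S n)) hle hcov
    (fun i => limit.π (hfm.functor.op ⋙ F.obj) (op i) ≫ toInverseImage F (f i).1 (f i).2 (hf i)) (by
      intro i j T hi hj x
      -- Both restrictions to `T` are computed from the component at `k`, since `T` lies in `f i ∩ f
      -- j ⊆ f k`.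
      obtain ⟨k, hki, hkj, hk⟩ := hinf i j
      have hTk : T.1 ≤ (f k).1 := (le_inf (show T.1 ≤ (f i).1 from hi) hj).trans hk
      have aux : ∀ l (hl : T ≤ (⟨(f l).1, hf l⟩ : SaTop X S n)) (hkl : k ≤ l),
          res (inverseImage F).obj hl ((limit.π (hfm.functor.op ⋙ F.obj) (op l) ≫
            toInverseImage F (f l).1 (f l).2 (hf l)).hom x) =
          canonical F hTk (π k x) := by
        intro l hl hkl
        rw [← hπ k l hkl x, canonical_res]
        refine Eq.trans ?_ (res_canonical F (Z := ⟨(f l).1, hf l⟩) le_rfl hl (π l x))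
        exact congrArg _ (toInverseImage_apply F _ _ _ (π l x))
      rw [aux i hi hki, aux j hj hkj])
  have hev : ∀ i x, res (inverseImage F).obj
      (show (⟨(f i).1, hf i⟩ : SaTop X S n) ≤ W from hle i) (e.hom x) =
      canonical F (Z := ⟨(f i).1, hf i⟩) le_rfl (π i x) := fun i x =>
    congr($(he i).hom x).trans (toInverseImage_apply F _ _ _ _)
  have hbij : Function.Bijective e.hom := by
    constructor
    · rw [injective_iff_map_eq_zero]
      intro x hx
      have h0 : ∀ i, π i x = 0 :=
        hinj _ (fun i j h => hπ i j h x) fun i => by rw [← hev, hx, map_zero]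
      -- Elements of the limit are tested as maps out of `ℂ`, lifted to the right universe, so only
      -- the universal property is used.
      have : ModuleCat.ofHom (LinearMap.toSpanSingleton ℂ _ x ∘ₗ
          (ULift.moduleEquiv (R := ℂ) (M := ℂ)).toLinearMap) = 0 := by
        refine limit.hom_ext fun i => ?_
        refine ModuleCat.hom_ext (LinearMap.ext fun z => ?_)
        refine (map_smul (π i.unop) z.down x).trans ?_
        rw [h0 i.unop, smul_zero, zero_comp]
        rfl
      simpa using congr($(this).hom ⟨1⟩)
    · intro α
      obtain ⟨x, hx, hxα⟩ := hsurj α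
      -- A compatible family of sections is a cone with apex `ℂ`; the element of the limit is the
      -- image of `1`.
      let c : Cone (hfm.functor.op ⋙ F.obj) :=
        { pt := ModuleCat.of ℂ (ULift.{max u v} ℂ)
          π :=
            { app := fun i => ModuleCat.ofHom (LinearMap.toSpanSingleton ℂ _ (x i.unop) ∘ₗ
                (ULift.moduleEquiv (R := ℂ) (M := ℂ)).toLinearMap)
              naturality := fun i j g => by
                refine ModuleCat.hom_ext (LinearMap.ext fun z => ?_)
                exact (congrArg (z.down • ·) (hx _ _ (leOfHom g.unop)).symm).trans
                  (map_smul (res F.obj (hfm (leOfHom g.unop))) z.down (x i.unop)).symm } }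
      have hcx : ∀ i, π i ((limit.lift _ c).hom (ULift.up 1)) = x i := fun i =>
        congr($(limit.lift_π c (op i)).hom (ULift.up 1)).trans (one_smul ℂ (x i))
      refine ⟨(limit.lift _ c).hom ⟨1⟩, eq_of_res_eq_of_cover (inverseImage F).property
        (Z := fun i => (⟨(f i).1, hf i⟩ : SaTop X S n)) hle hcov fun i => ?_⟩
      rw [hev, hcx, hxα]
  exact ⟨(LinearEquiv.ofBijective e.hom hbij).toModuleIso, he⟩

end Main

end RelSub

/-! ### The two projective limits -/

namespace RelSub

section

variable {n d : ℕ} {X : Type u} {S : Type v} [TopologicalSpace X] [TopologicalSpace S]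
  [ChartedSpace (EuclideanSpace ℝ (Fin n)) X] [ChartedSpace (EuclideanSpace ℝ (Fin d)) S]
  [T2Space X] [T2Space S] [IsManifold (𝓡 n) ω X] [IsManifold (𝓡 d) ω S]

variable (d) in
-- Interpolation: apply the finite refinement to the maximal sieve and take `M` to be the union of
-- the shrunk rectangles.
theorem IsInner.exists_between {W : SaTop X S n} {Y : Set (X × S)} (hY : IsInner n Y W.1) :
    ∃ (M : SaSa X S n d) (_ : IsRelSubanalytic X S n M.1),
      IsInner n Y M.1 ∧ IsInner n (M.1 : Set (X × S)) W.1 := by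
  obtain ⟨t, ht, h1, h2⟩ :=
    exists_finite_refinement (d := d) ((saTopTopology n X S).top_mem W) hY
  have hU : ∀ p ∈ t, IsSubanalytic n (p.1 : Set X) := fun p hp => (h1 p hp).2.2.2.2.choose
  let M : SaSa X S n d := ⟨⨆ p ∈ t, rect p.1 p.2.1, isBisubanalytic_biSup ht fun p hp =>
    ⟨p.1, p.2.1, ⟨hU p hp, (h1 p hp).1⟩, (h1 p hp).2.1, rfl⟩⟩
  have hMs : (M.1 : Set (X × S)) = ⋃ p ∈ t, (p.1 : Set X) ×ˢ (p.2.1 : Set S) := by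
    simp only [M, Opens.coe_iSup]
    rfl
  refine ⟨M, isRelSubanalytic_biSup ht hU, hMs ▸ h2, hMs ▸ isInner_biUnion ht fun p hp => ?_⟩
  obtain ⟨_, hle, -⟩ := (h1 p hp).2.2.2.2
  exact (isInner_prod (hU p hp) (h1 p hp).1 (h1 p hp).2.1.2 (h1 p hp).2.2.2.1).mono
    (Set.prod_mono_right subset_closure) hle

variable [SecondCountableTopology X] [SecondCountableTopology S] (F : SaSaSheaf n d X S)

theorem exists_limit_wqcSystem_iso (W : SaTop X S n) :
    ∃ e : limit (wqcSystem F W) ≅ (inverseImage F).obj.obj (op W),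
      ∀ W' : WeaklyQuasiCompactIn d W,
        e.hom ≫ (inverseImage F).obj.map (homOfLE W'.2.2.choose).op =
          limit.π (wqcSystem F W) (op W') ≫ toInverseImage F W'.1.1 W'.2.1 W'.1.2 := by
  have hI : ∀ W' : WeaklyQuasiCompactIn d W, IsInner n (W'.1.1 : Set (X × S)) W.1 := fun W' =>
    (isWeaklyQuasiCompact_iff d W'.2.2.choose).1 W'.2.2.choose_spec
  let mk : ∀ Y : SaTop X S n, IsBisubanalytic X S n d Y.1 → IsInner n (Y.1 : Set (X × S)) W.1 →
      WeaklyQuasiCompactIn d W := fun Y h h' =>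
    ⟨Y, h, h'.subset, (isWeaklyQuasiCompact_iff d _).2 h'⟩
  let f : WeaklyQuasiCompactIn d W → SaSa X S n d := fun W' => ⟨W'.1.1, W'.2.1⟩
  have hf : Monotone f := fun _ _ h => h
  refine exists_limit_iso F W (f := f) hf (fun W' => W'.1.2) (fun W' => W'.2.2.choose) ?_ ?_ ?_ ?_
  · intro i j
    exact ⟨mk ⟨i.1.1 ⊓ j.1.1, i.1.2.inf j.1.2⟩ (i.2.1.inf j.2.1)
      ((hI i).mono Set.inter_subset_left subset_rfl), inf_le_left (b := j.1.1),
      inf_le_right (a := i.1.1), le_rfl⟩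
  · refine ofObjects_mem_saTopTopology fun U hU hUc V hUV s hs _ _ => ?_
    obtain ⟨N, hsN, hN, hNV⟩ := exists_subanalytic_closure_subset (d := d) hs
    exact ⟨N, hsN, subset_closure.trans hNV, mk (SaTop.rect U hU N)
      (isBisubanalytic_of_mem ⟨U, N, ⟨hU, hUc⟩, hN, rfl⟩)
      ((isInner_prod hU hUc hN.2 hNV).mono (Set.prod_mono_right subset_closure) hUV), le_rfl⟩
  · intro x hx h0 i
    -- A zero image over `i` itself kills nothing on all of `i`. The component at an intermediate
    -- `M` has zero image as well, hence vanishes on `i`, which is inner in `M`.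
    obtain ⟨M, hM, h1, h2⟩ := (hI i).exists_between d
    let j := mk ⟨M.1, hM⟩ M.2 h2
    rw [← hx i j h1.subset]
    exact res_eq_zero_of_isInner F (Z := j.1) le_rfl (x j) (h0 j) _ h1
  · intro α
    obtain ⟨x, hx, hc⟩ := exists_innerSections F α
    exact ⟨fun i => x ⟨f i, hI i⟩, fun i j h => hx ⟨f i, hI i⟩ ⟨f j, hI j⟩ h,
      fun i => hc ⟨f i, hI i⟩ i.1 le_rfl⟩

theorem exists_limit_rectSystem_iso (U : Opens X) (hU : IsSubanalytic n (U : Set X))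
    (V : Opens S) :
    ∃ e : limit (rectSystem F U hU V) ≅ (inverseImage F).obj.obj (op (SaTop.rect U hU V)),
      ∀ V' : RelCompactSubanalytic d V,
        e.hom ≫ (inverseImage F).obj.map (homOfLE
            (Set.prod_mono_right (subset_closure.trans V'.2.2.2) :
              SaTop.rect U hU V'.1 ≤ SaTop.rect U hU V)).op =
          limit.π (rectSystem F U hU V) (op V') ≫
            toInverseImage F (rect U V'.1) (SaSa.rect U hU V'.1 V'.2.1 V'.2.2.1).2
              (SaTop.rect U hU V'.1).2 := by
  let f : RelCompactSubanalytic d V → SaSa X S n d := fun V' =>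
    SaSa.rect (n := n) U hU V'.1 V'.2.1 V'.2.2.1
  have hf : Monotone f := fun _ _ h => Set.prod_mono_right h
  have hfV : ∀ V', (f V').1 ≤ rect U V := fun V' =>
    Set.prod_mono_right (subset_closure.trans V'.2.2.2)
  let κ := {U' : Opens X // (IsSubanalytic n (U' : Set X) ∧ IsCompact (closure (U' : Set X))) ∧
    U' ≤ U}
  refine exists_limit_iso F (SaTop.rect U hU V) (f := f) hf (fun V' => (SaTop.rect U hU V'.1).2)
    hfV ?_ ?_ ?_ ?_
  · intro i j
    refine ⟨⟨i.1 ⊓ j.1, i.2.1.inter j.2.1, i.2.2.1.closure_of_subset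
      (Set.inter_subset_left.trans subset_closure),
      (closure_mono Set.inter_subset_left).trans i.2.2.2⟩, inf_le_left (b := j.1),
      inf_le_right (a := i.1), fun y hy => ⟨hy.1.1, hy.1.2, hy.2.2⟩⟩
  · refine ofObjects_mem_saTopTopology fun U' hU' hUc' V' hUV s hs x hx => ?_
    have hU'U : U' ≤ U := fun y hy => (hUV (show (y, s) ∈ rect U' V' from ⟨hy, hs⟩)).1
    have hV'V : V' ≤ V := fun y hy => (hUV (show (x, y) ∈ rect U' V' from ⟨hx, hy⟩)).2
    obtain ⟨N, hsN, hN, hNV⟩ := exists_subanalytic_closure_subset (d := d) hs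
    exact ⟨N, hsN, subset_closure.trans hNV, ⟨N, hN.1, hN.2, hNV.trans hV'V⟩,
      Set.prod_mono_left hU'U⟩
  · intro x hx h0 i
    -- Members `U' × P` of this covering of `U × V'` have `U'` relatively compact in `X` and `P ⊂⊂ N
    -- ⊂⊂ V`, so they are inner in `U × N`, where the image of `x N` is zero.
    let ι := {p : κ × Opens S // (IsSubanalytic d (p.2 : Set S) ∧
      IsCompact (closure (p.2 : Set S))) ∧ p.2 ≤ i.1 ∧
      ∃ N : RelCompactSubanalytic d V, closure (p.2 : Set S) ⊆ N.1}
    let Z : ι → SaSa X S n d := fun p =>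
      SaSa.rect p.1.1.1 p.1.1.2.1.1 p.1.2 p.2.1.1 p.2.1.2
    have hZ : ∀ p, Z p ≤ f i := fun p => Set.prod_mono p.1.1.2.2 p.2.2.1
    refine eq_of_res_eq_of_cover F.property hZ (rect_mem_saSaTopology hU _ _ hZ ?_) fun p => ?_
    · intro U' hU' hUc' hU'U
      choose! N hsN hN hNV using fun s (hs : s ∈ V) =>
        exists_subanalytic_closure_subset (d := d) hs
      choose! M hsM hM hMN using fun s (hs : s ∈ V) =>
        exists_subanalytic_closure_subset (d := d) (hsN s hs)
      obtain ⟨b, hb, hbV⟩ := i.2.2.1.elim_nhds_subcover (fun s => (M s : Set S))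
        fun s hs => (M s).isOpen.mem_nhds (hsM s (i.2.2.2 hs))
      have hbV' : ∀ s ∈ b, s ∈ V := fun s hs => i.2.2.2 (hb s hs)
      -- Finitely many `M s` cover the compact closure of `V'`; cutting them with `V'` gives the
      -- sets `P`, with `N s` as the larger set.
      let g : b → ι := fun s => ⟨(⟨U', ⟨hU', hUc'⟩, hU'U⟩, M s ⊓ i.1),
        ⟨(hM s (hbV' s s.2)).1.inter i.2.1, i.2.2.1.closure_of_subset
          (Set.inter_subset_right.trans subset_closure)⟩, inf_le_right,
        ⟨N s, (hN s (hbV' s s.2)).1, (hN s (hbV' s s.2)).2, hNV s (hbV' s s.2)⟩,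
        (closure_mono Set.inter_subset_left).trans (hMN s (hbV' s s.2))⟩
      refine ⟨Set.range g, Set.finite_range g, ?_⟩
      rintro ⟨y, s⟩ ⟨hy, hs⟩
      obtain ⟨s', hs', hss'⟩ := Set.mem_iUnion₂.1 (hbV (subset_closure hs))
      exact Set.mem_iUnion₂.2 ⟨g ⟨s', hs'⟩, ⟨_, rfl⟩, hy, hss', hs⟩
    · obtain ⟨N, hN⟩ := p.2.2.2
      let k : RelCompactSubanalytic d V := ⟨p.1.2, p.2.1.1, p.2.1.2,
        (closure_mono p.2.2.1).trans i.2.2.2⟩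
      have hk : Z p ≤ f k := Set.prod_mono_left p.1.1.2.2
      have hki : k ≤ i := p.2.2.1
      -- `N` and `i` need not be comparable, so `x i` and `x N` are compared through their common
      -- lower bound `k`.
      have hkN : k ≤ N := (subset_closure.trans hN : (p.1.2 : Set S) ⊆ N.1)
      rw [map_zero, ← res_res F.obj hk (hf hki), hx k i hki, ← hx k N hkN, res_res]
      refine res_eq_zero_of_isInner F (Z := SaTop.rect U hU N.1) le_rfl (x N) (h0 N) _ ?_
      exact (isInner_prod p.1.1.2.1.1 p.1.1.2.1.2 p.2.1.2 hN).mono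
        (Set.prod_mono_right subset_closure) (Set.prod_mono_left p.1.1.2.2)
  · intro α
    obtain ⟨x, hx, hc⟩ := exists_innerSections F α
    let Z : RelCompactSubanalytic d V → κ → SaSa X S n d := fun i p =>
      SaSa.rect p.1 p.2.1.1 i.1 i.2.1 i.2.2.1
    have hZ : ∀ i p, Z i p ≤ f i := fun i p => Set.prod_mono_left p.2.2
    have hZI : ∀ i p, IsInner n ((Z i p).1 : Set (X × S)) (rect U V) := fun i p =>
      (isInner_prod p.2.1.1 p.2.1.2 i.2.2.1 i.2.2.2).mono
        (Set.prod_mono_right subset_closure) (Set.prod_mono_left p.2.2)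
    have hcov : ∀ i, Sieve.ofObjects (Z i) (f i) ∈ saSaTopology n d X S (f i) := fun i =>
      rect_mem_saSaTopology hU _ _ (hZ i) fun U' hU' hUc' hU'U =>
        ⟨{⟨U', ⟨hU', hUc'⟩, hU'U⟩}, Set.finite_singleton _, by
          rw [Set.biUnion_singleton]; exact subset_rfl⟩
    -- The sections over the inner pieces `U' × V'` glue, in the site `X_sa × S_sa`, to a section
    -- over `U × V'`.
    have key : ∀ i, ∃ y : F.obj.obj (op (f i)), ∀ p, res F.obj (hZ i p) y = x ⟨Z i p, hZI i p⟩ :=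
      fun i => exists_glue F.property (hZ i) (hcov i) (fun p => x ⟨Z i p, hZI i p⟩)
        fun p q T hp hq => by
          have hT : IsInner n (T.1 : Set (X × S)) (rect U V) := (hZI i p).mono hp subset_rfl
          exact (hx ⟨T, hT⟩ ⟨Z i p, hZI i p⟩ hp).trans (hx ⟨T, hT⟩ ⟨Z i q, hZI i q⟩ hq).symm
    choose y hy using key
    refine ⟨y, fun i j h => ?_, fun i => ?_⟩
    · refine eq_of_res_eq_of_cover F.property (hZ i) (hcov i) fun p => ?_
      have hij : Z i p ≤ Z j p := Set.prod_mono_right h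
      rw [res_res, hy, ← res_res F.obj hij (hZ j p), hy]
      exact hx ⟨Z i p, hZI i p⟩ ⟨Z j p, hZI j p⟩ hij
    · let Z' : κ → SaTop X S n := fun p => SaTop.rect p.1 p.2.1.1 i.1
      have hZ' : ∀ p, Z' p ≤ SaTop.rect U hU i.1 := fun p => Set.prod_mono_left p.2.2
      refine eq_of_res_eq_of_cover (inverseImage F).property (W := SaTop.rect U hU i.1) hZ'
        (ofObjects_mem_saTopTopology fun U' hU' hUc' V' hUV s hs x hx => ?_) fun p => ?_
      · exact ⟨V', hs, le_rfl, ⟨U', ⟨hU', hUc'⟩,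
          fun y hy => (hUV (show (y, s) ∈ rect U' V' from ⟨hy, hs⟩)).1⟩,
          Set.prod_mono_right fun y hy => (hUV (show (x, y) ∈ rect U' V' from ⟨hx, hy⟩)).2⟩
      · have h1 : (Z' p).1 ≤ (Z i p).1 := le_refl (rect p.1 i.1)
        refine (res_canonical F (Y := f i) (Z := SaTop.rect U hU i.1) le_rfl (hZ' p) (y i)).trans ?_
        refine Eq.trans ?_ ((hc ⟨Z i p, hZI i p⟩ (Z' p) h1).trans (res_res _ _ _ _).symm)
        rw [← hy i p, canonical_res]

end

end RelSub

theorem mainTheorem5 {n d : ℕ} (X : Type u) (S : Type v)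
    [TopologicalSpace X] [T2Space X] [SecondCountableTopology X]
    [ChartedSpace (EuclideanSpace ℝ (Fin n)) X] [IsManifold (𝓡 n) ω X]
    [TopologicalSpace S] [T2Space S] [SecondCountableTopology S]
    [ChartedSpace (EuclideanSpace ℝ (Fin d)) S] [IsManifold (𝓡 d) ω S]
    (F : RelSub.SaSaSheaf n d X S) :
    (∀ (U : Opens X) (hU : RelSub.IsSubanalytic n (U : Set X)) (V : Opens S),
      ∃ e : limit (RelSub.rectSystem F U hU V) ≅
          (RelSub.inverseImage F).obj.obj (op (RelSub.SaTop.rect U hU V)),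
        ∀ V' : RelSub.RelCompactSubanalytic d V,
          e.hom ≫ (RelSub.inverseImage F).obj.map (homOfLE
              (Set.prod_mono_right (subset_closure.trans V'.2.2.2) :
                RelSub.SaTop.rect U hU V'.1 ≤ RelSub.SaTop.rect U hU V)).op =
            limit.π (RelSub.rectSystem F U hU V) (op V') ≫
              RelSub.toInverseImage F (RelSub.rect U V'.1)
                (RelSub.SaSa.rect U hU V'.1 V'.2.1 V'.2.2.1).2
                (RelSub.SaTop.rect U hU V'.1).2) ∧
    (∀ W : RelSub.SaTop X S n,
      ∃ e : limit (RelSub.wqcSystem F W) ≅ (RelSub.inverseImage F).obj.obj (op W),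
        ∀ W' : RelSub.WeaklyQuasiCompactIn d W,
          e.hom ≫ (RelSub.inverseImage F).obj.map (homOfLE W'.2.2.choose).op =
            limit.π (RelSub.wqcSystem F W) (op W') ≫
              RelSub.toInverseImage F W'.1.1 W'.2.1 W'.1.2) := by
  exact ⟨RelSub.exists_limit_rectSystem_iso F, RelSub.exists_limit_wqcSystem_iso F⟩
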